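/- **Setting.** Let $N=\{0,\dots,n-1\}$ be a set of $n$ nodes and let $D\in\mathbb Q_{\ge 0}^{n\times n}$ be a demand matrix: $D_{ij}$ units of data have to be sent from $i$ to $j$. In the time-expanded network with vertices $(i,t)$, $0\le t\le T$, there are virtual edges $(i,t)\to(i,t+1)$ and physical edges $(i,t)\to(j,t+1)$ with $i\ne j$. Let $\mathcal P(i,j,t)$ be the set of directed paths from $(i,0)$ to $(j,t)$. An *indirect integral routing of makespan $T$ for $D$* is a function $f\ge 0$ on $\bigcup_{i,j\in N,\,1\le t\le T}\mathcal P(i,j,t)$ such that every physical edge carries at most one unit of flow, $\sum_{t=1}^{T}\sum_{P\in\mathcal P(i,j,t)}f(P)\ge D_{ij}$ for all $i,j$, and at every time step each node has at most one outgoing and at most one incoming physical edge that carries positive flow. Its average completion time is $$\Big(\sum_{t=1}^{T}\sum_{i,j}\sum_{P\in\mathcal P(i,j,t)}t\cdot f(P)\Big)\Big/\sum_{i,j}D_{ij}$$ (and $0$ if $D=0$). Schedules are written down in run-length encoding: as the makespan and a list of items, each consisting of a path, a number $m\ge 0$ and a rational amount, which stands for sending that amount along each of the $m$ paths obtained by delaying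 all moves and the arrival of the given path by $0,1,\dots,m-1$ time units. All numbers are in binary. **Theorem.** There is an algorithm $\mathrm{ALG}$ that, given any $n$ and any demand matrix $D\in\mathbb Q_{\ge0}^{n\times n}$, outputs an indirect integral routing for $D$, in time polynomial in the bit length of $D$ (on a random access machine with logarithmic cost), with the following properties. 1. There is an absolute constant $C$ such that for all $n\ge 2$, all real $B$ and all $D$ all of whose row sums and column sums are at most $B$, both the makespan and the average completion time of $\mathrm{ALG}$ on $D$ are at most - $C\log n$ if $B\le 2$, - $C\,\dfrac{B\log n}{\log B}$ if $2\le B\le n$, - $C\,B$ if $B\ge n$. 2. There is an absolute constant $c>0$ such that for all $n\ge2$ and all rational $B>0$, if every entry of $D$ equals $B/n$, then every indirect integral routing for $D$ has both makespan and average completion time at least $$c\cdot\max\Big\{\log n,\ \frac{B\log n}{\log B},\ B\Big\},$$ where the middle term is present only for $B\ge 2$. 3. Consequently $\mathrm{ALG}$ is worst-case optimal for both objectives: there is an absolute constant $K$ such that for all $n\ge 2$, all rational $B>0$ and all $D$ with row and column sums at most $B$, the makespan (respectively average completion time) of $\mathrm{ALG}$ on $D$ is at most $K$ times the makespan (respectively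 average completion time) of every indirect integral routing for the matrix with all entries $B/n$. -/

import Mathlib

/-! ## Flows over time -/

/-- A flow over time on the node set `{0, …, n - 1}`.  In the time-expanded network a directed path
from `(i, 0)` to `(j, t)` visits exactly one node at each of the times `0, …, t`, so it is a
function `p : Fin (t + 1) → Fin n`; its step at time `s` is a virtual edge if `p s = p (s + 1)` and
a physical edge otherwise.  `f t p` is the amount of data sent along `p`, which arrives at
time `t`. -/
abbrev TimedFlow (n : ℕ) : Type := (t : ℕ) → (Fin (t + 1) → Fin n) → ℝ

/-- The path `p`, which ends at time `t`, uses the edge `(a, s) → (b, s + 1)`. -/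
def Uses {n t : ℕ} (p : Fin (t + 1) → Fin n) (s : ℕ) (a b : Fin n) : Prop :=
  ∃ r : Fin t, r.val = s ∧ p r.castSucc = a ∧ p r.succ = b

open Classical in
/-- The amount of data that the flow `f`, with time horizon `T`, sends over the edge
`(a, s) → (b, s + 1)`. -/
noncomputable def load {n : ℕ} (T : ℕ) (f : TimedFlow n) (s : ℕ) (a b : Fin n) : ℝ :=
  ∑ t ∈ Finset.Icc 1 T, ∑ p : Fin (t + 1) → Fin n, if Uses p s a b then f t p else 0

open Classical in
/-- The amount of data that the flow `f` sends along paths from `(i, 0)` to `(j, t)`. -/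
noncomputable def delivered {n : ℕ} (f : TimedFlow n) (i j : Fin n) (t : ℕ) : ℝ :=
  ∑ p : Fin (t + 1) → Fin n, if p 0 = i ∧ p (Fin.last t) = j then f t p else 0

/-- `f` is a feasible (indirect, possibly fractional) routing of makespan `T` for the demands `D`:
it is nonnegative, every physical edge carries at most one unit, and every demand is met. -/
structure IsFeasible {n : ℕ} (D : Matrix (Fin n) (Fin n) NNRat) (T : ℕ) (f : TimedFlow n) : Prop where
  nonneg : ∀ t p, 0 ≤ f t p
  capacity : ∀ s a b, a ≠ b → load T f s a b ≤ 1
  demand : ∀ i j, (D i j : ℝ) ≤ ∑ t ∈ Finset.Icc 1 T, delivered f i j t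

/-- `f` is integral: at every time step the physical edges that carry a positive amount of data
form a matching, that is, every node sends to at most one other node and receives from at most one
other node. -/
structure IsIntegralFlow {n : ℕ} (T : ℕ) (f : TimedFlow n) : Prop where
  out_unique : ∀ s a b b', a ≠ b → a ≠ b' → 0 < load T f s a b → 0 < load T f s a b' → b = b'
  in_unique : ∀ s a a' b, a ≠ b → a' ≠ b → 0 < load T f s a b → 0 < load T f s a' b → a = a'

/-- `f` is a feasible indirect integral routing of makespan `T` for the demands `D`. -/
def IsIntegralRouting {n : ℕ} (D : Matrix (Fin n) (Fin n) NNRat) (T : ℕ) (f : TimedFlow n) : Prop :=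
  IsFeasible D T f ∧ IsIntegralFlow T f

/-- The total completion time of `f` with time horizon `T`. -/
noncomputable def totalCompletionTime {n : ℕ} (T : ℕ) (f : TimedFlow n) : ℝ :=
  ∑ t ∈ Finset.Icc 1 T, ∑ i : Fin n, ∑ j : Fin n, (t : ℝ) * delivered f i j t

/-- The average completion time: the total completion time per unit of demand
(it is `0` if there is no demand at all). -/
noncomputable def avgCompletionTime {n : ℕ} (D : Matrix (Fin n) (Fin n) NNRat) (T : ℕ)
    (f : TimedFlow n) : ℝ :=
  totalCompletionTime T f / ∑ i : Fin n, ∑ j : Fin n, (D i j : ℝ)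

/-- All row sums and all column sums of `D` are at most `B`. -/
def SumsAtMost {n : ℕ} (D : Matrix (Fin n) (Fin n) NNRat) (B : ℝ) : Prop :=
  (∀ i, ∑ j, (D i j : ℝ) ≤ B) ∧ (∀ j, ∑ i, (D i j : ℝ) ≤ B)

/-- The demand matrix all of whose entries are `B / n`. -/
def uniformDemand (n : ℕ) (B : NNRat) : Matrix (Fin n) (Fin n) NNRat := fun _ _ => B / n

/-- `max {log n, B log n / log B, B}`, where the middle term is present only for `2 ≤ B`. -/
noncomputable def worstCaseRate (n : ℕ) (B : ℝ) : ℝ :=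
  max (Real.log n) (max (if 2 ≤ B then B * Real.log n / Real.log B else 0) B)

/-! ## Schedules as finite objects

A makespan may be exponential in the bit length of the demands, so an algorithm writes down a
schedule in run-length encoding: a list of bundles, each standing for a path together with a number
of consecutive time shifts of it. -/

/-- A bundle of `copies` many paths that all carry the same amount `num / den` of data.  Path number
`0` starts at `src`, moves to node `v` during the step from time `τ` to time `τ + 1` for every
`(τ, v)` in `hops` (listed by increasing time), waits at all other times, and ends at time
`arrival`.  Path number `k` makes all the moves, and ends, `k` time units later. -/
structure Bundle (n : ℕ) where
  src : Fin n
  hops : List (ℕ × Fin n)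
  arrival : ℕ
  copies : ℕ
  num : ℕ
  den : ℕ

/-- The node that path number `k` of the bundle occupies at time `s`. -/
def Bundle.position {n : ℕ} (b : Bundle n) (k s : ℕ) : Fin n :=
  b.hops.foldl (fun x h => if h.1 + k < s then h.2 else x) b.src

/-- A schedule: its makespan and the list of its bundles. -/
structure Schedule (n : ℕ) where
  makespan : ℕ
  bundles : List (Bundle n)

open Classical in
/-- The flow that a schedule describes. -/
noncomputable def Schedule.flow {n : ℕ} (S : Schedule n) : TimedFlow n := fun t p =>
  (S.bundles.map fun b => ∑ k ∈ Finset.range b.copies,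
    if b.arrival + k = t ∧ ∀ s : Fin (t + 1), p s = b.position k s
      then (b.num : ℝ) / (b.den : ℝ) else 0).sum

/-- The average completion time of a schedule for the demands `D`. -/
noncomputable def Schedule.avg {n : ℕ} (S : Schedule n) (D : Matrix (Fin n) (Fin n) NNRat) : ℝ :=
  avgCompletionTime D S.makespan S.flow

/-- A bundle as a list of numbers. -/
def Bundle.encode {n : ℕ} (b : Bundle n) : List ℕ :=
  b.src.val :: b.hops.length :: b.hops.flatMap (fun h => [h.1, h.2.val]) ++
    [b.arrival, b.copies, b.num, b.den]

/-- A schedule as a list of numbers. -/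
def Schedule.encode {n : ℕ} (S : Schedule n) : List ℕ :=
  S.makespan :: S.bundles.length :: S.bundles.flatMap Bundle.encode

/-- A demand matrix as a list of numbers: `n`, and then row by row the numerator and the denominator
of every entry. -/
def encodeDemand {n : ℕ} (D : Matrix (Fin n) (Fin n) NNRat) : List ℕ :=
  n :: (List.finRange n).flatMap fun i =>
    (List.finRange n).flatMap fun j => [(D i j).num, (D i j).den]

/-! ## Random access machines with logarithmic cost -/

/-- The memory of the machine: `m b a` is the natural number in cell `a` of memory bank `b`.
A program names its banks explicitly, so it uses only finitely many of them; the address of a cell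
may be computed. -/
abbrev Memory : Type := ℕ → ℕ → ℕ

/-- The arithmetic operations on natural numbers (truncated subtraction, quotient, remainder). -/
inductive BinOp
  | add | sub | mul | div | mod

/-- The result of an arithmetic operation. -/
def BinOp.eval : BinOp → ℕ → ℕ → ℕ
  | .add, x, y => x + y
  | .sub, x, y => x - y
  | .mul, x, y => x * y
  | .div, x, y => x / y
  | .mod, x, y => x % y

/-- Expressions: constants, memory cells, arithmetic operations. -/
inductive Expr
  | const (k : ℕ)
  | cell (bank : ℕ) (addr : Expr)
  | op (o : BinOp) (e₁ e₂ : Expr)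

/-- The value of an expression. -/
def Expr.eval (m : Memory) : Expr → ℕ
  | .const k => k
  | .cell b e => m b (e.eval m)
  | .op o e₁ e₂ => o.eval (e₁.eval m) (e₂.eval m)

/-- The time needed to evaluate an expression: every operation costs one plus the bit lengths of
its operands and of its result. -/
def Expr.cost (m : Memory) : Expr → ℕ
  | .const k => k.size + 1
  | .cell b e => e.cost m + ((e.eval m).size + (m b (e.eval m)).size + 1)
  | .op o e₁ e₂ => e₁.cost m + e₂.cost m +
      ((e₁.eval m).size + (e₂.eval m).size + (o.eval (e₁.eval m) (e₂.eval m)).size + 1)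

/-- Programs. -/
inductive Program
  | skip
  | store (bank : ℕ) (addr val : Expr)
  | seq (c₁ c₂ : Program)
  | branch (cond : Expr) (c₁ c₂ : Program)
  | loop (cond : Expr) (c : Program)

/-- The memory after `x` has been written into cell `a` of bank `b`. -/
def Memory.write (m : Memory) (b a x : ℕ) : Memory :=
  Function.update m b (Function.update (m b) a x)

/-- `Runs c m k m'`: started with memory `m`, the program `c` halts after time `k` with memory `m'`.
A condition holds if its value is not zero; `loop e c` repeats `c` as long as `e` holds. -/
inductive Runs : Program → Memory → ℕ → Memory → Prop
  | skip (m : Memory) : Runs .skip m 1 m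
  | store (b : ℕ) (a e : Expr) (m : Memory) :
      Runs (.store b a e) m (a.cost m + e.cost m + ((a.eval m).size + (e.eval m).size + 1))
        (m.write b (a.eval m) (e.eval m))
  | seq {c₁ c₂ : Program} {m m₁ m₂ : Memory} {k₁ k₂ : ℕ} :
      Runs c₁ m k₁ m₁ → Runs c₂ m₁ k₂ m₂ → Runs (.seq c₁ c₂) m (k₁ + k₂) m₂
  | branch_true {e : Expr} {c₁ c₂ : Program} {m m' : Memory} {k : ℕ} :
      e.eval m ≠ 0 → Runs c₁ m k m' → Runs (.branch e c₁ c₂) m (e.cost m + 1 + k) m'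
  | branch_false {e : Expr} {c₁ c₂ : Program} {m m' : Memory} {k : ℕ} :
      e.eval m = 0 → Runs c₂ m k m' → Runs (.branch e c₁ c₂) m (e.cost m + 1 + k) m'
  | loop_true {e : Expr} {c : Program} {m m₁ m₂ : Memory} {k₁ k₂ : ℕ} :
      e.eval m ≠ 0 → Runs c m k₁ m₁ → Runs (.loop e c) m₁ k₂ m₂ →
        Runs (.loop e c) m (e.cost m + 1 + k₁ + k₂) m₂
  | loop_false {e : Expr} {c : Program} {m : Memory} :
      e.eval m = 0 → Runs (.loop e c) m (e.cost m + 1) m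

/-- The memory at the start: the input list in bank `0`, and zeros everywhere else. -/
def startMemory (L : List ℕ) : Memory := fun b a => if b = 0 then L.getD a 0 else 0

/-- At the end the list `L` can be read off from the first cells of bank `1`. -/
def HoldsOutput (m : Memory) (L : List ℕ) : Prop := ∀ a, a < L.length → m 1 a = L.getD a 0

/-- The bit length of a list of numbers. -/
def bitLength (L : List ℕ) : ℕ := (L.map fun x => x.size + 1).sum

/-- A scheduling algorithm runs in polynomial time: a single program turns the encoding of every
demand matrix into the encoding of the schedule that the algorithm chooses, within a time that is
polynomial in the bit length of the demand matrix. -/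
def IsPolyTime (ALG : (n : ℕ) → Matrix (Fin n) (Fin n) NNRat → Schedule n) : Prop :=
  ∃ (c : Program) (q : Polynomial ℕ), ∀ (n : ℕ) (D : Matrix (Fin n) (Fin n) NNRat),
    ∃ (k : ℕ) (m : Memory), Runs c (startMemory (encodeDemand D)) k m ∧
      k ≤ q.eval (bitLength (encodeDemand D)) ∧ HoldsOutput m (ALG n D).encode

/-! The upper bound is oblivious two-phase routing. A unit from `i` to `j` goes to an intermediate
node at a uniformly spread distance `x` and then on to `j`, and both distances are covered digit by
digit in base `b`. A time step fixes one digit position and one digit value, so everything that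
moves at that step moves by the same shift modulo `n`. A shift is a permutation, hence the flow is
integral. Fixing one digit leaves at most `b ^ (d - 1)` of the `N` distances, and for each of them a
node sees only one row of `D` (first phase) or one column (second phase), so slots of length about
`2 * β / b` respect the capacities when all sums are at most `β` (`spreadSchedule_load_le`). With `b
= min β n` and `d` about `log n / log b`, the makespan `2 * d * b * m + 1 + m` is of order `β * log
n / log b` (`spreadAlgorithm_makespan_le`). The demands are delivered exactly, so the makespan also
bounds the average completion time.

The lower bound plays reach against work. Integrality leaves each node at most one successor per
step, so with at most `h` hops in `s` steps a unit reaches at most as many nodes as there are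
choices of at most `h` of the `s` steps (`card_reachable_le`). Data for all other nodes makes at
least `h + 1` hops, while only `n` hops' worth of volume fits into one step (`sum_pathHops_le`).
Hence at least a quarter of a uniform demand is still missing at time `τ` for suitable `τ`
(`uniform_lower_bound`), and three choices of `τ`, `h`, `z` give the three terms of the rate
(`worstCaseRate_le`).

For polynomial time, an explicit program computes the parameters and writes the bundles. Its loops
run over nodes, digits and distances, all at most the input length because `b ^ d ≤ n ^ 2`. The slot
length may be exponential, but it only enters as a number, through `copies`. A syntactic cost bound
for programs with bounded loops and bounded cells then gives the polynomial. -/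

/-! ## Time bounds for programs -/

/-- A bound for the bit length of the value of an expression if every memory cell holds a number of
bit length at most `S`. -/
def Expr.valueSize (S : ℕ) : Expr → ℕ
  | .const k => k.size
  | .cell _ _ => S
  | .op _ e₁ e₂ => e₁.valueSize S + e₂.valueSize S + 1

/-- A bound for the cost of an expression if every memory cell holds a number of bit length at
most `S`. -/
def Expr.costBound (S : ℕ) : Expr → ℕ
  | .const k => k.size + 1
  | .cell _ e => e.costBound S + (e.valueSize S + S + 1)
  | .op _ e₁ e₂ => e₁.costBound S + e₂.costBound S +
      (e₁.valueSize S + e₂.valueSize S + (e₁.valueSize S + e₂.valueSize S + 1) + 1)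

/-- A bound for the running time of a program if every loop is repeated at most `N` times and all
memory cells hold numbers of bit length at most `S` throughout. -/
def Program.timeBound (N S : ℕ) : Program → ℕ
  | .skip => 1
  | .store _ a e => a.costBound S + e.costBound S + (a.valueSize S + e.valueSize S + 1)
  | .seq c₁ c₂ => c₁.timeBound N S + c₂.timeBound N S
  | .branch e c₁ c₂ => e.costBound S + 1 + (c₁.timeBound N S + c₂.timeBound N S)
  | .loop e c => (N + 1) * (e.costBound S + 1 + c.timeBound N S)

theorem Nat.size_mul_le (x y : ℕ) : (x * y).size ≤ x.size + y.size := by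
  rw [Nat.size_le, pow_add]
  exact Nat.mul_lt_mul'' (Nat.lt_size_self x) (Nat.lt_size_self y)

theorem Nat.size_add_le (x y : ℕ) : (x + y).size ≤ x.size + y.size + 1 := by
  rw [Nat.size_le, pow_succ, pow_add]
  have hx := Nat.lt_size_self x
  have hy := Nat.lt_size_self y
  have hx' : 1 ≤ 2 ^ x.size := Nat.one_le_two_pow
  have hy' : 1 ≤ 2 ^ y.size := Nat.one_le_two_pow
  nlinarith

theorem BinOp.size_eval_le (o : BinOp) (x y : ℕ) : (o.eval x y).size ≤ x.size + y.size + 1 := by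
  cases o
  · exact Nat.size_add_le x y
  · exact (Nat.size_le_size (Nat.sub_le x y)).trans (by omega)
  · exact (Nat.size_mul_le x y).trans (by omega)
  · exact (Nat.size_le_size (Nat.div_le_self x y)).trans (by omega)
  · exact (Nat.size_le_size (Nat.mod_le x y)).trans (by omega)

theorem Expr.size_eval_le {m : Memory} {S : ℕ} (h : ∀ b a, (m b a).size ≤ S) (e : Expr) :
    (e.eval m).size ≤ e.valueSize S := by
  induction e with
  | const k => exact le_rfl
  | cell b e _ => exact h _ _
  | op o e₁ e₂ h₁ h₂ =>
    have := o.size_eval_le (e₁.eval m) (e₂.eval m)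
    simp only [Expr.eval, Expr.valueSize]
    omega

theorem Expr.cost_le {m : Memory} {S : ℕ} (h : ∀ b a, (m b a).size ≤ S) (e : Expr) :
    e.cost m ≤ e.costBound S := by
  induction e with
  | const k => exact le_rfl
  | cell b e ih =>
    have h₁ := e.size_eval_le h
    have h₂ := h b (e.eval m)
    simp only [Expr.cost, Expr.costBound]
    omega
  | op o e₁ e₂ h₁ h₂ =>
    have h₃ := o.size_eval_le (e₁.eval m) (e₂.eval m)
    have h₄ := e₁.size_eval_le h
    have h₅ := e₂.size_eval_le h
    simp only [Expr.cost, Expr.costBound]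
    omega

theorem Expr.exists_polynomial_valueSize (p : Polynomial ℕ) (e : Expr) :
    ∃ q : Polynomial ℕ, ∀ L, q.eval L = e.valueSize (p.eval L) := by
  induction e with
  | const k => exact ⟨Polynomial.C k.size, fun L => by simp [Expr.valueSize]⟩
  | cell b e _ => exact ⟨p, fun L => rfl⟩
  | op o e₁ e₂ h₁ h₂ =>
    obtain ⟨q₁, h₁⟩ := h₁
    obtain ⟨q₂, h₂⟩ := h₂
    exact ⟨q₁ + q₂ + 1, fun L => by simp [Expr.valueSize, h₁, h₂]⟩

theorem Expr.exists_polynomial_costBound (p : Polynomial ℕ) (e : Expr) :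
    ∃ q : Polynomial ℕ, ∀ L, q.eval L = e.costBound (p.eval L) := by
  induction e with
  | const k => exact ⟨Polynomial.C (k.size + 1), fun L => by simp [Expr.costBound]⟩
  | cell b e h =>
    obtain ⟨q, h⟩ := h
    obtain ⟨r, hr⟩ := e.exists_polynomial_valueSize p
    exact ⟨q + (r + p + 1), fun L => by simp [Expr.costBound, h, hr]⟩
  | op o e₁ e₂ h₁ h₂ =>
    obtain ⟨q₁, h₁⟩ := h₁
    obtain ⟨q₂, h₂⟩ := h₂
    obtain ⟨r₁, hr₁⟩ := e₁.exists_polynomial_valueSize p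
    obtain ⟨r₂, hr₂⟩ := e₂.exists_polynomial_valueSize p
    exact ⟨q₁ + q₂ + (r₁ + r₂ + (r₁ + r₂ + 1) + 1), fun L => by
      simp [Expr.costBound, h₁, h₂, hr₁, hr₂]⟩

/-- The nesting depth of the loops is fixed by the program, so the bound is a polynomial in the loop
limit and the cell size. Here the loop limit is `L` itself and the cell size is `p.eval L`. -/
theorem Program.exists_polynomial_timeBound (p : Polynomial ℕ) (c : Program) :
    ∃ q : Polynomial ℕ, ∀ L, q.eval L = c.timeBound L (p.eval L) := by
  induction c with
  | skip => exact ⟨1, fun L => by simp [Program.timeBound]⟩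
  | store b a e =>
    obtain ⟨q₁, h₁⟩ := a.exists_polynomial_costBound p
    obtain ⟨q₂, h₂⟩ := e.exists_polynomial_costBound p
    obtain ⟨r₁, hr₁⟩ := a.exists_polynomial_valueSize p
    obtain ⟨r₂, hr₂⟩ := e.exists_polynomial_valueSize p
    exact ⟨q₁ + q₂ + (r₁ + r₂ + 1), fun L => by simp [Program.timeBound, h₁, h₂, hr₁, hr₂]⟩
  | seq c₁ c₂ h₁ h₂ =>
    obtain ⟨q₁, h₁⟩ := h₁
    obtain ⟨q₂, h₂⟩ := h₂
    exact ⟨q₁ + q₂, fun L => by simp [Program.timeBound, h₁, h₂]⟩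
  | branch e c₁ c₂ h₁ h₂ =>
    obtain ⟨q₁, h₁⟩ := h₁
    obtain ⟨q₂, h₂⟩ := h₂
    obtain ⟨q, h⟩ := e.exists_polynomial_costBound p
    exact ⟨q + 1 + (q₁ + q₂), fun L => by simp [Program.timeBound, h, h₁, h₂]⟩
  | loop e c h₁ =>
    obtain ⟨q₁, h₁⟩ := h₁
    obtain ⟨q, h⟩ := e.exists_polynomial_costBound p
    exact ⟨(Polynomial.X + 1) * (q + 1 + q₁), fun L => by simp [Program.timeBound, h, h₁]⟩

/-- Started in `m`, a memory whose cells hold numbers at most `M`, the program halts within its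
time bound in a memory with the same property that satisfies `Q`. -/
def Program.Achieves (N M : ℕ) (c : Program) (m : Memory) (Q : Memory → Prop) : Prop :=
  (∀ b a, m b a ≤ M) → ∃ k m', Runs c m k m' ∧ k ≤ c.timeBound N M.size ∧
    (∀ b a, m' b a ≤ M) ∧ Q m'

/-- The address needs no bound of its own: its size is already controlled by the shape of the
expression and the sizes of the cells it reads. -/
theorem Program.achieves_store {N M b : ℕ} {a e : Expr} {m : Memory} {Q : Memory → Prop}
    (he : e.eval m ≤ M) (hQ : Q (m.write b (a.eval m) (e.eval m))) :
    (Program.store b a e).Achieves N M m Q := by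
  intro hm
  have hS : ∀ b a, (m b a).size ≤ M.size := fun b a => Nat.size_le_size (hm b a)
  refine ⟨_, _, Runs.store b a e m, ?_, ?_, hQ⟩
  · have h₁ := a.cost_le hS
    have h₂ := e.cost_le hS
    have h₃ := a.size_eval_le hS
    have h₄ := e.size_eval_le hS
    simp only [Program.timeBound]
    omega
  · intro b' a'
    simp only [Memory.write, Function.update_apply]
    split_ifs
    · rw [Function.update_apply]
      split_ifs
      exacts [he, hm _ _]
    · exact hm _ _

theorem Program.achieves_seq {N M : ℕ} {c₁ c₂ : Program} {m : Memory} {Q : Memory → Prop}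
    (h : c₁.Achieves N M m fun m' => c₂.Achieves N M m' Q) : (c₁.seq c₂).Achieves N M m Q := by
  intro hm
  obtain ⟨k₁, m₁, r₁, t₁, s₁, h₁⟩ := h hm
  obtain ⟨k₂, m₂, r₂, t₂, s₂, h₂⟩ := h₁ s₁
  exact ⟨_, _, r₁.seq r₂, by simp only [Program.timeBound]; omega, s₂, h₂⟩

/-- The invariant is indexed by the number of completed rounds. The number `K` of rounds is known in
advance, so termination and cost come together. -/
theorem Program.achieves_loop {N M K : ℕ} {e : Expr} {c : Program} {m : Memory}
    {Q : Memory → Prop} (I : ℕ → Memory → Prop) (hK : K ≤ N) (h₀ : I 0 m)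
    (hcond : ∀ k < K, ∀ m, I k m → e.eval m ≠ 0)
    (hbody : ∀ k < K, ∀ m, I k m → c.Achieves N M m (I (k + 1)))
    (hexit : ∀ m, I K m → e.eval m = 0) (hQ : ∀ m, I K m → Q m) :
    (Program.loop e c).Achieves N M m Q := by
  -- Induction on the number `j` of rounds still to come; the extra `1` in `j + 1` pays for the
  -- final failing test.
  have key : ∀ j ≤ K, ∀ m, (∀ b a, m b a ≤ M) → I (K - j) m → ∃ k m', Runs (.loop e c) m k m' ∧
      k ≤ (j + 1) * (e.costBound M.size + 1 + c.timeBound N M.size) ∧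
      (∀ b a, m' b a ≤ M) ∧ Q m' := by
    intro j
    induction j with
    | zero =>
      intro _ m hm hI
      have h₁ := e.cost_le (m := m) (S := M.size) fun b a => Nat.size_le_size (hm b a)
      exact ⟨_, _, Runs.loop_false (hexit m hI), by omega, hm, hQ m hI⟩
    | succ j ih =>
      intro hj m hm hI
      have h₁ := e.cost_le (m := m) (S := M.size) fun b a => Nat.size_le_size (hm b a)
      obtain ⟨k₁, m₁, r₁, t₁, s₁, i₁⟩ := hbody _ (by omega) m hI hm
      rw [show K - (j + 1) + 1 = K - j by omega] at i₁
      obtain ⟨k₂, m₂, r₂, t₂, s₂, q₂⟩ := ih (by omega) m₁ s₁ i₁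
      refine ⟨_, _, Runs.loop_true (hcond _ (by omega) m hI) r₁ r₂, ?_, s₂, q₂⟩
      rw [add_mul (j + 1)]
      omega
  intro hm
  obtain ⟨k, m', r, t, s, q⟩ := key K le_rfl m hm (by simpa using h₀)
  refine ⟨k, m', r, t.trans ?_, s, q⟩
  exact Nat.mul_le_mul_right _ (by omega)

/-! ## Programs with variables, reading a list and writing a list -/

/-- Terms over program variables and cells of the input. -/
inductive PTerm
  | const (k : ℕ)
  | var (v : ℕ)
  | input (t : PTerm)
  | op (o : BinOp) (t₁ t₂ : PTerm)

namespace PTerm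

/-- Variables live in bank `2`, the input in bank `0`. -/
def toExpr : PTerm → Expr
  | const k => .const k
  | var v => .cell 2 (.const v)
  | input t => .cell 0 t.toExpr
  | op o t₁ t₂ => .op o t₁.toExpr t₂.toExpr

/-- The value of a term if the input is `inp` and the variables have the values `σ`. -/
def val (inp : List ℕ) (σ : ℕ → ℕ) : PTerm → ℕ
  | const k => k
  | var v => σ v
  | input t => inp.getD (t.val inp σ) 0
  | op o t₁ t₂ => o.eval (t₁.val inp σ) (t₂.val inp σ)

instance : Add PTerm := ⟨op .add⟩
instance : Sub PTerm := ⟨op .sub⟩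
instance : Mul PTerm := ⟨op .mul⟩
instance : Div PTerm := ⟨op .div⟩
instance : Mod PTerm := ⟨op .mod⟩

variable (inp : List ℕ) (σ : ℕ → ℕ) (t₁ t₂ : PTerm)

@[simp] theorem val_const (k : ℕ) : (const k).val inp σ = k := rfl
@[simp] theorem val_var (v : ℕ) : (var v).val inp σ = σ v := rfl
@[simp] theorem val_input : (input t₁).val inp σ = inp.getD (t₁.val inp σ) 0 := rfl
@[simp] theorem val_add : (t₁ + t₂).val inp σ = t₁.val inp σ + t₂.val inp σ := rfl
@[simp] theorem val_sub : (t₁ - t₂).val inp σ = t₁.val inp σ - t₂.val inp σ := rfl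
@[simp] theorem val_mul : (t₁ * t₂).val inp σ = t₁.val inp σ * t₂.val inp σ := rfl
@[simp] theorem val_div : (t₁ / t₂).val inp σ = t₁.val inp σ / t₂.val inp σ := rfl
@[simp] theorem val_mod : (t₁ % t₂).val inp σ = t₁.val inp σ % t₂.val inp σ := rfl

end PTerm

/-- The memory `m` holds the input `inp`, the variables `σ` and the output `out` with its length. -/
structure Represents (inp : List ℕ) (σ : ℕ → ℕ) (out : List ℕ) (m : Memory) : Prop where
  input : ∀ a, m 0 a = inp.getD a 0
  vars : m 2 = σ
  output : HoldsOutput m out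
  length : m 3 0 = out.length

theorem Represents.eval_toExpr {inp : List ℕ} {σ : ℕ → ℕ} {out : List ℕ} {m : Memory}
    (h : Represents inp σ out m) (t : PTerm) : t.toExpr.eval m = t.val inp σ := by
  induction t with
  | const k => rfl
  | var v => exact congrFun h.vars v
  | input t ih =>
    simp only [PTerm.toExpr, Expr.eval, ih, PTerm.val]
    exact h.input _
  | op o t₁ t₂ h₁ h₂ => simp only [PTerm.toExpr, Expr.eval, h₁, h₂, PTerm.val]

namespace Program

/-- Give the variable `v` the value of `t`. -/
def assign (v : ℕ) (t : PTerm) : Program := .store 2 (.const v) t.toExpr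

/-- Append the value of `t` to the output. -/
def emit (t : PTerm) : Program :=
  .seq (.store 1 (.cell 3 (.const 0)) t.toExpr)
    (.store 3 (.const 0) (.op .add (.cell 3 (.const 0)) (.const 1)))

/-- Repeat `c` as long as `t` is not zero. -/
def repeatWhile (t : PTerm) (c : Program) : Program := .loop t.toExpr c

/-- Run the programs of a list one after the other. -/
def block : List Program → Program
  | [] => .skip
  | c :: l => .seq c (block l)

/-- Started with variables `σ` and output `out`, the program achieves `Q`. -/
def Transforms (N M : ℕ) (inp : List ℕ) (c : Program) (σ : ℕ → ℕ) (out : List ℕ)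
    (Q : (ℕ → ℕ) → List ℕ → Prop) : Prop :=
  ∀ m, Represents inp σ out m →
    c.Achieves N M m fun m' => ∃ σ' out', Represents inp σ' out' m' ∧ Q σ' out'

variable {N M : ℕ} {inp : List ℕ} {σ : ℕ → ℕ} {out : List ℕ} {Q : (ℕ → ℕ) → List ℕ → Prop}

theorem Achieves.mono {c : Program} {m : Memory} {Q R : Memory → Prop} (h : c.Achieves N M m Q)
    (hQR : ∀ m, Q m → R m) : c.Achieves N M m R := by
  intro hm
  obtain ⟨k, m', r, t, s, q⟩ := h hm
  exact ⟨k, m', r, t, s, hQR _ q⟩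

theorem transforms_assign {v : ℕ} {t : PTerm} (ht : t.val inp σ ≤ M)
    (hQ : Q (Function.update σ v (t.val inp σ)) out) : (assign v t).Transforms N M inp σ out Q := by
  intro m hm
  refine achieves_store (by rwa [hm.eval_toExpr]) ⟨_, _, ?_, hQ⟩
  rw [hm.eval_toExpr]
  constructor
  · intro a
    simpa [Memory.write] using hm.input a
  · simp [Memory.write, Expr.eval, hm.vars]
  · intro a ha
    simpa [Memory.write] using hm.output a ha
  · simpa [Memory.write] using hm.length

/-- The output length is itself stored in a cell, as the next free address, so it has to respect the
limit `M` as well. -/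
theorem transforms_emit {t : PTerm} (ht : t.val inp σ ≤ M) (hout : out.length + 1 ≤ M)
    (hQ : Q σ (out ++ [t.val inp σ])) : (emit t).Transforms N M inp σ out Q := by
  intro m hm
  refine achieves_seq (achieves_store (by rwa [hm.eval_toExpr]) (achieves_store ?_ ?_))
  · simpa [Expr.eval, BinOp.eval, Memory.write, hm.length] using hout
  · refine ⟨_, _, ?_, hQ⟩
    rw [hm.eval_toExpr]
    constructor
    · intro a
      simpa [Memory.write] using hm.input a
    · simpa [Memory.write] using hm.vars
    · intro a ha
      simp only [List.length_append, List.length_cons, List.length_nil] at ha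
      simp only [Memory.write, Expr.eval, hm.length]
      rcases eq_or_ne a out.length with rfl | hne
      · simp
      · have h := hm.output a (by omega)
        simp only [ne_eq, OfNat.one_ne_ofNat, not_false_eq_true, Function.update_of_ne,
          Function.update_self, hne, h]
        rw [List.getD_append _ _ _ _ (by omega)]
    · simp [Memory.write, Expr.eval, BinOp.eval, hm.length]

theorem transforms_seq {c₁ c₂ : Program}
    (h : c₁.Transforms N M inp σ out fun σ' out' => c₂.Transforms N M inp σ' out' Q) :
    (c₁.seq c₂).Transforms N M inp σ out Q := fun m hm =>
  achieves_seq ((h m hm).mono fun m' ⟨_, _, hm', h'⟩ => h' m' hm')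

theorem transforms_nil (hQ : Q σ out) : (block []).Transforms N M inp σ out Q := fun m hm hs =>
  ⟨1, m, Runs.skip m, le_rfl, hs, σ, out, hm, hQ⟩

theorem transforms_cons {c : Program} {l : List Program}
    (h : c.Transforms N M inp σ out fun σ' out' => (block l).Transforms N M inp σ' out' Q) :
    (block (c :: l)).Transforms N M inp σ out Q := transforms_seq h

theorem Transforms.mono {c : Program} {R : (ℕ → ℕ) → List ℕ → Prop}
    (h : c.Transforms N M inp σ out Q) (hQR : ∀ σ out, Q σ out → R σ out) :
    c.Transforms N M inp σ out R := fun m hm =>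
  (h m hm).mono fun _ ⟨σ', out', hm', h'⟩ => ⟨σ', out', hm', hQR _ _ h'⟩

theorem transforms_repeatWhile {K : ℕ} {t : PTerm} {c : Program}
    (I : ℕ → (ℕ → ℕ) → List ℕ → Prop) (hK : K ≤ N) (h₀ : I 0 σ out)
    (hcond : ∀ k < K, ∀ σ out, I k σ out → t.val inp σ ≠ 0)
    (hbody : ∀ k < K, ∀ σ out, I k σ out → c.Transforms N M inp σ out (I (k + 1)))
    (hexit : ∀ σ out, I K σ out → t.val inp σ = 0) (hQ : ∀ σ out, I K σ out → Q σ out) :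
    (repeatWhile t c).Transforms N M inp σ out Q := by
  intro m hm
  refine achieves_loop (fun k m => ∃ σ out, Represents inp σ out m ∧ I k σ out) hK
    ⟨σ, out, hm, h₀⟩ ?_ ?_ ?_ ?_
  · rintro k hk m ⟨σ, out, hm, hI⟩
    rw [hm.eval_toExpr]
    exact hcond k hk σ out hI
  · rintro k hk m ⟨σ, out, hm, hI⟩
    exact hbody k hk σ out hI m hm
  · rintro m ⟨σ, out, hm, hI⟩
    rw [hm.eval_toExpr]
    exact hexit σ out hI
  · rintro m ⟨σ, out, hm, hI⟩
    exact ⟨σ, out, hm, hQ σ out hI⟩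

/-- A program that turns `inp` into `out` halts within its time bound. -/
theorem Transforms.exists_runs {c : Program}
    (h : c.Transforms N M inp (fun _ => 0) [] fun _ out' => out' = out)
    (hinp : ∀ a, inp.getD a 0 ≤ M) :
    ∃ k m, Runs c (startMemory inp) k m ∧ k ≤ c.timeBound N M.size ∧ HoldsOutput m out := by
  obtain ⟨k, m, r, t, -, σ', out', hm, rfl⟩ := h (startMemory inp)
    ⟨fun a => by simp [startMemory], funext fun a => by simp [startMemory],
      fun a ha => by simp at ha, by simp [startMemory]⟩
    (fun b a => by unfold startMemory; split_ifs; exacts [hinp a, Nat.zero_le _])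
  exact ⟨k, m, r, t, hm.output⟩

end Program

/-! ## Sums over the paths of a schedule -/

-- Each copy of a bundle is a single path with a single arrival time, so after exchanging the sums
-- it selects one term of the sum over `t` and `p`. Loads and deliveries are both sums of this kind,
-- with an indicator as the weight `w`.
open Classical in
theorem Schedule.sum_flow {n : ℕ} (S : Schedule n) (T : ℕ)
    (w : (t : ℕ) → (Fin (t + 1) → Fin n) → ℝ) :
    ∑ t ∈ Finset.Icc 1 T, ∑ p : Fin (t + 1) → Fin n, w t p * S.flow t p =
      (S.bundles.map fun b => ∑ k ∈ Finset.range b.copies,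
        if b.arrival + k ∈ Finset.Icc 1 T
          then w (b.arrival + k) (fun s => b.position k s) * ((b.num : ℝ) / (b.den : ℝ))
          else 0).sum := by
  unfold Schedule.flow
  induction S.bundles with
  | nil => simp
  | cons b l ih =>
    simp only [List.map_cons, List.sum_cons, mul_add, Finset.sum_add_distrib, ih]
    congr 1
    simp only [Finset.mul_sum]
    rw [Finset.sum_congr rfl fun t _ => Finset.sum_comm, Finset.sum_comm]
    refine Finset.sum_congr rfl fun k _ => ?_
    have aux : ∀ t, (∑ p : Fin (t + 1) → Fin n, w t p *
        if b.arrival + k = t ∧ ∀ s : Fin (t + 1), p s = b.position k s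
          then (b.num : ℝ) / (b.den : ℝ) else 0) =
        if b.arrival + k = t then w t (fun s => b.position k s) * ((b.num : ℝ) / (b.den : ℝ))
          else 0 := by
      intro t
      split_ifs with ht
      · refine (Finset.sum_eq_single (fun s : Fin (t + 1) => b.position k s) (fun p _ hp => ?_)
          fun h => absurd (Finset.mem_univ _) h).trans ?_
        · rw [if_neg, mul_zero]
          rintro ⟨-, h⟩
          exact hp (funext h)
        · simp [ht]
      · simp [ht]
    rw [Finset.sum_congr rfl fun t _ => aux t, Finset.sum_ite_eq]

/-- What a walker who makes the hops `0, …, Q - 1` at the times `t q + k` and has reached `V q`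
after `q` hops does between the times `s` and `s + 1`. -/
theorem foldl_hops_succ {α : Type*} (V : ℕ → α) {t : ℕ → ℕ} (ht : StrictMono t) (k s Q : ℕ) :
    ((List.range Q).map fun q => (t q, V (q + 1))).foldl
        (fun x h => if h.1 + k < s + 1 then h.2 else x) (V 0) =
      ((List.range Q).map fun q => (t q, V (q + 1))).foldl
        (fun x h => if h.1 + k < s then h.2 else x) (V 0) ∨
    ∃ q < Q, s = t q + k ∧
      ((List.range Q).map fun q => (t q, V (q + 1))).foldl
        (fun x h => if h.1 + k < s then h.2 else x) (V 0) = V q ∧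
      ((List.range Q).map fun q => (t q, V (q + 1))).foldl
        (fun x h => if h.1 + k < s + 1 then h.2 else x) (V 0) = V (q + 1) := by
  -- If all hops lie in the past, the last of them decides the position.
  have hall : ∀ Q, (∀ q < Q, t q + k < s) → ((List.range Q).map fun q => (t q, V (q + 1))).foldl
      (fun x h => if h.1 + k < s then h.2 else x) (V 0) = V Q := by
    intro Q hQ
    cases Q with
    | zero => rfl
    | succ Q => simp [List.range_succ, hQ Q (Nat.lt_succ_self Q)]
  induction Q with
  | zero => exact Or.inl rfl
  | succ Q ih =>
    simp only [List.range_succ, List.map_append, List.map_cons, List.map_nil, List.foldl_append,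
      List.foldl_cons, List.foldl_nil]
    rcases lt_trichotomy (t Q + k) s with h | h | h
    · left
      rw [if_pos h, if_pos (by omega)]
    · right
      refine ⟨Q, Nat.lt_succ_self Q, h.symm, ?_, if_pos (by omega)⟩
      rw [if_neg (by omega)]
      refine hall Q fun q hq => ?_
      have := ht hq
      omega
    · rw [if_neg (by omega), if_neg (by omega)]
      rcases ih with ih | ⟨q, hq, ih⟩
      · exact Or.inl ih
      · exact Or.inr ⟨q, by omega, ih⟩

theorem foldl_hops_of_forall_lt {α : Type*} (V : ℕ → α) {t : ℕ → ℕ} {k s Q : ℕ}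
    (h : ∀ q < Q, t q + k < s) : ((List.range Q).map fun q => (t q, V (q + 1))).foldl
      (fun x h => if h.1 + k < s then h.2 else x) (V 0) = V Q := by
  cases Q with
  | zero => rfl
  | succ Q => simp [List.range_succ, h Q (Nat.lt_succ_self Q)]

theorem foldl_hops_zero {α : Type*} (l : List (ℕ × α)) (v : α) (k : ℕ) :
    l.foldl (fun x h => if h.1 + k < 0 then h.2 else x) v = v := by
  induction l with
  | nil => rfl
  | cons h l ih => simp

/-! ## Two-phase routing through random intermediate nodes

A unit from `i` to `j` first travels a random distance `x < N`, then the remaining distance `y`,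
modulo `n`.  Both distances are written with `d` digits in base `b`.  There is one time slot, of
length `m`, for every value of every digit. -/

/-- The distance that remains, as a number below the multiple `N` of `n`. -/
def remainingDistance (n N i j x : ℕ) : ℕ := (j + n - i + (N - x)) % N

/-- The hops of the path from `i` to `j` via distance `x`. -/
def spreadHops (n b d m N : ℕ) (i j : Fin n) (x : ℕ) : List (ℕ × Fin n) :=
  ((List.range d).map fun s =>
    ((s * b + x / b ^ s % b) * m, ⟨(i + x % b ^ (s + 1)) % n, Nat.mod_lt _ i.pos⟩)) ++
  ((List.range d).map fun s =>
    (((d + s) * b + remainingDistance n N i j x / b ^ s % b) * m,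
      ⟨(i + x + remainingDistance n N i j x % b ^ (s + 1)) % n, Nat.mod_lt _ i.pos⟩))

/-- The bundle for the demand from `i` to `j` via distance `x`. -/
def spreadBundle {n : ℕ} (b d m N : ℕ) (D : Matrix (Fin n) (Fin n) NNRat) (i j : Fin n) (x : ℕ) :
    Bundle n where
  src := i
  hops := spreadHops n b d m N i j x
  arrival := 2 * d * b * m + 1
  copies := m
  num := (D i j).num
  den := (D i j).den * N * m

/-- The schedule that sends a fraction `1 / N` of every demand via every distance `x < N`. -/
def spreadSchedule {n : ℕ} (b d m N : ℕ) (D : Matrix (Fin n) (Fin n) NNRat) : Schedule n where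
  makespan := 2 * d * b * m + 1 + m
  bundles := (List.finRange n).flatMap fun i => (List.finRange n).flatMap fun j =>
    (List.range N).map (spreadBundle b d m N D i j)

/-- Digit number `q` of the pair `(x, y)` of `d`-digit numbers. -/
def pairDigit (b d x y q : ℕ) : ℕ := if q < d then x / b ^ q % b else y / b ^ (q - d) % b

/-- The weight of digit number `q`. -/
def pairWeight (b d q : ℕ) : ℕ := if q < d then b ^ q else b ^ (q - d)

/-- The distance covered by the first `q` digits. -/
def pairPrefix (b d x y q : ℕ) : ℕ := if q < d then x % b ^ q else x + y % b ^ (q - d)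

/-- With no digits at all, position `0` already counts as the second phase, where the prefix
contains all of `x`; hence the side condition. -/
theorem pairPrefix_zero (b d x y : ℕ) (h : d = 0 → x = 0) : pairPrefix b d x y 0 = 0 := by
  unfold pairPrefix
  split_ifs with hd
  · simp [Nat.mod_one]
  · simp [h (by omega), Nat.mod_one]

/-- Within a phase this is the base `b` expansion. At the change of phase, `q + 1 = d`, the prefix
switches from `x % b ^ d` to `x`, which needs `x < b ^ d`. -/
theorem pairPrefix_succ {b d x : ℕ} (hx : x < b ^ d) (y q : ℕ) :
    pairPrefix b d x y (q + 1) =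
      pairPrefix b d x y q + pairDigit b d x y q * pairWeight b d q := by
  unfold pairPrefix pairDigit pairWeight
  rcases lt_trichotomy (q + 1) d with h | h | h
  · rw [if_pos h, if_pos (by omega), if_pos (by omega), if_pos (by omega), Nat.mod_pow_succ,
      mul_comm (b ^ q)]
  · subst h
    rw [if_neg (by omega), if_pos (by omega), if_pos (by omega), if_pos (by omega), Nat.sub_self,
      pow_zero, Nat.mod_one, add_zero]
    conv_lhs => rw [← Nat.mod_eq_of_lt hx, Nat.mod_pow_succ, mul_comm (b ^ q)]
  · rw [if_neg (by omega), if_neg (by omega), if_neg (by omega), if_neg (by omega),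
      show q + 1 - d = q - d + 1 by omega, Nat.mod_pow_succ, mul_comm (b ^ _), add_assoc]

theorem pairDigit_lt {b : ℕ} (hb : 0 < b) (d x y q : ℕ) : pairDigit b d x y q < b := by
  unfold pairDigit
  split_ifs <;> exact Nat.mod_lt _ hb

/-- The node reached after `q` hops. -/
def spreadNode (n b d N : ℕ) (i j : Fin n) (x q : ℕ) : Fin n :=
  ⟨(i + pairPrefix b d x (remainingDistance n N i j x) q) % n, Nat.mod_lt _ i.pos⟩

/-- The time of hop number `q` of the first path of a bundle. -/
def spreadTime (n b d m N : ℕ) (i j : Fin n) (x q : ℕ) : ℕ :=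
  (q * b + pairDigit b d x (remainingDistance n N i j x) q) * m

theorem spreadHops_eq {n b d m N : ℕ} {i j : Fin n} {x : ℕ} (hx : x < b ^ d) :
    spreadHops n b d m N i j x = (List.range (d + d)).map fun q =>
      (spreadTime n b d m N i j x q, spreadNode n b d N i j x (q + 1)) := by
  rw [List.range_add, List.map_append, List.map_map, spreadHops]
  congr 1
  · refine List.map_congr_left fun s hs => ?_
    have hs : s < d := List.mem_range.1 hs
    simp only [spreadTime, spreadNode, pairDigit, pairPrefix, if_pos hs]
    split_ifs with h
    · rfl
    · rw [show d = s + 1 by omega] at hx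
      simp [show s + 1 - d = 0 by omega, Nat.mod_eq_of_lt hx, Nat.mod_one]
  · refine List.map_congr_left fun s hs => ?_
    simp [spreadTime, spreadNode, pairDigit, pairPrefix, add_assoc]

/-- Hop `q` happens in the `q`-th group of `b` slots, since its digit is less than `b`. -/
theorem strictMono_spreadTime {b m : ℕ} (hb : 0 < b) (hm : 0 < m) (n d N : ℕ) (i j : Fin n)
    (x : ℕ) : StrictMono (spreadTime n b d m N i j x) := by
  refine strictMono_nat_of_lt_succ fun q => Nat.mul_lt_mul_of_pos_right ?_ hm
  have := pairDigit_lt hb d x (remainingDistance n N i j x) q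
  rw [add_mul]
  omega

theorem spreadTime_lt {b m : ℕ} (hb : 0 < b) {n d N : ℕ} {i j : Fin n}
    {x q k : ℕ} (hq : q < d + d) (hk : k < m) : spreadTime n b d m N i j x q + k < 2 * d * b * m := by
  have h := pairDigit_lt hb d x (remainingDistance n N i j x) q
  have h₁ : (q + 1) * b ≤ 2 * d * b := Nat.mul_le_mul_right _ (by omega)
  have h₂ : (q * b + pairDigit b d x (remainingDistance n N i j x) q + 1) * m ≤ 2 * d * b * m :=
    Nat.mul_le_mul_right _ (by linarith)
  unfold spreadTime
  linarith

section Bundle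

variable {n b d m N : ℕ} {D : Matrix (Fin n) (Fin n) NNRat} {i j : Fin n} {x k : ℕ}

theorem spreadBundle_position (hx : x < b ^ d) (s : ℕ) :
    (spreadBundle b d m N D i j x).position k s =
      ((List.range (d + d)).map fun q =>
        (spreadTime n b d m N i j x q, spreadNode n b d N i j x (q + 1))).foldl
        (fun x h => if h.1 + k < s then h.2 else x) (spreadNode n b d N i j x 0) := by
  have h0 : spreadNode n b d N i j x 0 = i := by
    have : pairPrefix b d x (remainingDistance n N i j x) 0 = 0 :=
      pairPrefix_zero _ _ _ _ (by rintro rfl; simpa using hx)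
    simp [spreadNode, this, Nat.mod_eq_of_lt i.2]
  rw [h0, ← spreadHops_eq hx]
  rfl

theorem spreadBundle_position_zero : (spreadBundle b d m N D i j x).position k 0 = i :=
  foldl_hops_zero _ _ _

/-- As `n` divides `N`, the reduction modulo `N` is invisible modulo `n`. This is why the number of
distances has to be a multiple of `n`. -/
theorem remainingDistance_spec (hN : n ∣ N) (hx : x < N) :
    (i + x + remainingDistance n N i j x) % n = j := by
  obtain ⟨c, rfl⟩ := hN
  have hi := i.2
  rw [remainingDistance, Nat.add_mod, Nat.mod_mod_of_dvd _ (Dvd.intro _ rfl), ← Nat.add_mod,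
    show i + x + (j + n - i + (n * c - x)) = j + n * (c + 1) by rw [mul_add]; omega,
    Nat.add_mul_mod_self_left, Nat.mod_eq_of_lt j.2]

theorem spreadBundle_position_last (hb : 0 < b) (hNb : N ≤ b ^ d) (hN : n ∣ N) (hx : x < N)
    (hk : k < m) {s : ℕ} (hs : 2 * d * b * m ≤ s) :
    (spreadBundle b d m N D i j x).position k s = j := by
  rw [spreadBundle_position (hx.trans_le hNb), foldl_hops_of_forall_lt]
  · have hy : remainingDistance n N i j x < b ^ d :=
      (Nat.mod_lt _ (by omega)).trans_le hNb
    ext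
    simp only [spreadNode, pairPrefix]
    rw [if_neg (by omega), Nat.add_sub_cancel, Nat.mod_eq_of_lt hy, ← add_assoc,
      remainingDistance_spec hN hx]
  · intro q hq
    exact (spreadTime_lt hb hq hk).trans_le hs

/-- Every move of a path is made in the slot that belongs to the digit in question. -/
theorem spreadBundle_step (hb : 0 < b) (hNb : N ≤ b ^ d) (hx : x < N) (hk : k < m) (s : ℕ)
    (hs : (spreadBundle b d m N D i j x).position k s ≠
      (spreadBundle b d m N D i j x).position k (s + 1)) :
    k = s % m ∧ s / m / b < d + d ∧
      pairDigit b d x (remainingDistance n N i j x) (s / m / b) = s / m % b ∧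
      (spreadBundle b d m N D i j x).position k s = spreadNode n b d N i j x (s / m / b) ∧
      ((spreadBundle b d m N D i j x).position k (s + 1)).val =
        ((spreadBundle b d m N D i j x).position k s + s / m % b * pairWeight b d (s / m / b)) % n := by
  have hx' := hx.trans_le hNb
  have hm : 0 < m := by omega
  simp only [spreadBundle_position hx'] at hs ⊢
  rcases foldl_hops_succ (spreadNode n b d N i j x) (strictMono_spreadTime hb hm n d N i j x) k s
    (d + d) with h | ⟨q, hq, rfl, h₁, h₂⟩
  · exact absurd h.symm hs
  · rw [h₁, h₂]
    have hd := pairDigit_lt hb d x (remainingDistance n N i j x) q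
    have e₁ : (spreadTime n b d m N i j x q + k) / m =
        q * b + pairDigit b d x (remainingDistance n N i j x) q := by
      rw [spreadTime, Nat.mul_comm _ m, Nat.mul_add_div hm, Nat.div_eq_of_lt hk, add_zero]
    have e₂ : (spreadTime n b d m N i j x q + k) % m = k := by
      rw [spreadTime, Nat.mul_add_mod', Nat.mod_eq_of_lt hk]
    have e₃ : (q * b + pairDigit b d x (remainingDistance n N i j x) q) / b = q := by
      rw [Nat.mul_comm, Nat.mul_add_div hb, Nat.div_eq_of_lt hd, add_zero]
    have e₄ : (q * b + pairDigit b d x (remainingDistance n N i j x) q) % b =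
        pairDigit b d x (remainingDistance n N i j x) q := by
      rw [Nat.mul_add_mod', Nat.mod_eq_of_lt hd]
    rw [e₁, e₂, e₃, e₄]
    refine ⟨rfl, hq, rfl, rfl, ?_⟩
    simp only [spreadNode, pairPrefix_succ hx', ← add_assoc, Nat.mod_add_mod]

end Bundle

/-! ## Feasibility of two-phase routing -/

theorem List.sum_map_flatMap {α β : Type*} (l : List α) (f : α → List β) (g : β → ℝ) :
    ((l.flatMap f).map g).sum = (l.map fun a => ((f a).map g).sum).sum := by
  induction l with
  | nil => rfl
  | cons a l ih => simp [ih]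

theorem Finset.sum_ite_le_of_subsingleton {ι : Type*} (s : Finset ι) (P : ι → Prop)
    [DecidablePred P] (hP : ∀ i ∈ s, ∀ j ∈ s, P i → P j → i = j) {r : ι → ℝ} {c : ℝ} (hc : 0 ≤ c)
    (hr : ∀ i, r i ≤ c) : (∑ i ∈ s, if P i then r i else 0) ≤ c := by
  by_cases h : ∃ i ∈ s, P i
  · obtain ⟨i, hi, hPi⟩ := h
    rw [Finset.sum_eq_single_of_mem i hi fun j hj hji =>
      if_neg fun hPj => hji (hP j hj i hi hPj hPi), if_pos hPi]
    exact hr i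
  · rw [Finset.sum_eq_zero fun i hi => if_neg fun hPi => h ⟨i, hi, hPi⟩]
    exact hc

/-- Fixing one of `d` digits leaves `b ^ (d - 1)` numbers. -/
theorem card_filter_digit_le {b d N q : ℕ} (hb : 0 < b) (hN : N ≤ b ^ d) (hq : q < d) (a : ℕ) :
    ((Finset.range N).filter fun x => x / b ^ q % b = a).card ≤ b ^ (d - 1) := by
  rw [← Finset.card_range (b ^ (d - 1))]
  have hbq : 0 < b ^ q := pow_pos hb q
  -- The map deletes digit `q`: the lower digits stay and the higher ones move down by one place.
  refine Finset.card_le_card_of_injOn (fun x => x % b ^ q + b ^ q * (x / b ^ (q + 1))) ?_ ?_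
  · intro x hx
    simp only [Finset.coe_filter, Finset.mem_range, Set.mem_ofPred_eq] at hx
    simp only [Finset.coe_range, Set.mem_Iio]
    have h₁ : x % b ^ q < b ^ q := Nat.mod_lt _ hbq
    have h₂ : x / b ^ (q + 1) < b ^ (d - 1 - q) := by
      rw [Nat.div_lt_iff_lt_mul (pow_pos hb _), ← pow_add, show d - 1 - q + (q + 1) = d by omega]
      omega
    calc x % b ^ q + b ^ q * (x / b ^ (q + 1)) < b ^ q * (x / b ^ (q + 1) + 1) := by
          rw [mul_add]; omega
      _ ≤ b ^ q * b ^ (d - 1 - q) := Nat.mul_le_mul_left _ h₂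
      _ = b ^ (d - 1) := by rw [← pow_add]; congr 1; omega
  · intro x hx x' hx' h
    simp only [Finset.coe_filter, Finset.mem_range, Set.mem_ofPred_eq] at hx hx' h
    have e₁ : x % b ^ q = x' % b ^ q := by
      have := congrArg (· % b ^ q) h
      simpa using this
    have e₂ : x / b ^ (q + 1) = x' / b ^ (q + 1) := by
      rw [e₁] at h
      exact Nat.eq_of_mul_eq_mul_left hbq (Nat.add_left_cancel h)
    have e₃ : x / b ^ q = x' / b ^ q := by
      rw [pow_succ, ← Nat.div_div_eq_div_mul, ← Nat.div_div_eq_div_mul] at e₂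
      rw [← Nat.div_add_mod (x / b ^ q) b, ← Nat.div_add_mod (x' / b ^ q) b, e₂, hx.2, hx'.2]
    rw [← Nat.div_add_mod x (b ^ q), ← Nat.div_add_mod x' (b ^ q), e₁, e₃]

/-- For fixed endpoints, `x` is sent to a constant minus `x` modulo `N`. So the second distance is
spread as evenly as the first, and sums over `x` can be turned into sums over it. -/
theorem injOn_remainingDistance {n N : ℕ} (i j : ℕ) :
    Set.InjOn (remainingDistance n N i j) (Finset.range N) := by
  intro x hx x' hx' h
  simp only [Finset.coe_range, Set.mem_Iio] at hx hx'
  have h₁ : N - x ≡ N - x' [MOD N] := Nat.ModEq.add_left_cancel' _ h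
  have h₂ := h₁.add_right (x + x')
  rw [show N - x + (x + x') = x' + N by omega, show N - x' + (x + x') = x + N by omega] at h₂
  exact (Nat.ModEq.eq_of_lt_of_lt (Nat.ModEq.add_right_cancel' _ h₂) hx' hx).symm

section Spread

variable {n b d m N : ℕ} {D : Matrix (Fin n) (Fin n) NNRat}

/-- Copy `k < m` of every bundle arrives at time `2 * d * b * m + 1 + k`, which lies within the
makespan, so no copy is cut off. -/
theorem spreadSchedule_sum_flow (w : (t : ℕ) → (Fin (t + 1) → Fin n) → ℝ) :
    ∑ t ∈ Finset.Icc 1 (spreadSchedule b d m N D).makespan, ∑ p : Fin (t + 1) → Fin n,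
      w t p * (spreadSchedule b d m N D).flow t p =
    ∑ i, ∑ j, ∑ x ∈ Finset.range N, ∑ k ∈ Finset.range m,
      w (2 * d * b * m + 1 + k) (fun s => (spreadBundle b d m N D i j x).position k s) *
        ((D i j : ℝ) / (N * m)) := by
  rw [Schedule.sum_flow]
  simp only [spreadSchedule, List.sum_map_flatMap, ← Fin.sum_univ_def, List.map_map]
  refine Finset.sum_congr rfl fun i _ => Finset.sum_congr rfl fun j _ => ?_
  change ∑ x ∈ Finset.range N, _ = _
  refine Finset.sum_congr rfl fun x _ => Finset.sum_congr rfl fun k hk => ?_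
  have hk : k < m := Finset.mem_range.1 hk
  have h₁ : 1 ≤ 2 * d * b * m + 1 + k := by omega
  have h₂ : 2 * d * b * m + 1 + k ≤ 2 * d * b * m + 1 + m := by omega
  refine (if_pos (Finset.mem_Icc.2 ⟨h₁, h₂⟩)).trans ?_
  have h₃ : ((D i j).num : ℝ) / ((D i j).den * N * m : ℕ) = (D i j : ℝ) / (N * m) := by
    rw [NNRat.cast_def (D i j), div_div]
    push_cast
    rw [mul_assoc]
  rw [← h₃]
  rfl

theorem spreadSchedule_load_eq (s : ℕ) (a c : Fin n) [∀ t p, Decidable (@Uses n t p s a c)] :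
    load (spreadSchedule b d m N D).makespan (spreadSchedule b d m N D).flow s a c =
    ∑ i, ∑ j, ∑ x ∈ Finset.range N, ∑ k ∈ Finset.range m,
      if Uses (fun r : Fin (2 * d * b * m + 1 + k + 1) =>
        (spreadBundle b d m N D i j x).position k r) s a c then (D i j : ℝ) / (N * m) else 0 := by
  classical
  have := spreadSchedule_sum_flow (b := b) (d := d) (m := m) (N := N) (D := D)
    fun t p => if Uses p s a c then 1 else 0
  simp only [ite_mul, one_mul, zero_mul] at this
  rw [load]
  convert this

theorem Uses.position {B : Bundle n} {k t s : ℕ} {a c : Fin n}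
    (h : Uses (fun r : Fin (t + 1) => B.position k r) s a c) :
    B.position k s = a ∧ B.position k (s + 1) = c := by
  obtain ⟨r, rfl, h₁, h₂⟩ := h
  exact ⟨h₁, h₂⟩

/-- All moves made at time `s` are by the same distance modulo `n`. -/
theorem spreadSchedule_move (hb : 0 < b) (hNb : N ≤ b ^ d) {s : ℕ} {a c : Fin n} (hac : a ≠ c)
    (h : 0 < load (spreadSchedule b d m N D).makespan (spreadSchedule b d m N D).flow s a c) :
    c.val = (a + s / m % b * pairWeight b d (s / m / b)) % n := by
  classical
  rw [spreadSchedule_load_eq] at h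
  obtain ⟨i, -, h⟩ := Finset.exists_ne_zero_of_sum_ne_zero h.ne'
  obtain ⟨j, -, h⟩ := Finset.exists_ne_zero_of_sum_ne_zero h
  obtain ⟨x, hx, h⟩ := Finset.exists_ne_zero_of_sum_ne_zero h
  obtain ⟨k, hk, h⟩ := Finset.exists_ne_zero_of_sum_ne_zero h
  obtain ⟨rfl, rfl⟩ := (not_not.1 fun hu => h (if_neg hu)).position
  exact (spreadBundle_step hb hNb (Finset.mem_range.1 hx) (Finset.mem_range.1 hk) s hac).2.2.2.2

/-- A shift modulo `n` is a permutation of the nodes, so both successor and predecessor are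
determined. -/
theorem spreadSchedule_isIntegralFlow (hb : 0 < b) (hNb : N ≤ b ^ d) :
    IsIntegralFlow (spreadSchedule b d m N D).makespan (spreadSchedule b d m N D).flow where
  out_unique s a c c' hc hc' h h' := by
    ext
    rw [spreadSchedule_move hb hNb hc h, spreadSchedule_move hb hNb hc' h']
  in_unique s a a' c ha ha' h h' := by
    have e := spreadSchedule_move hb hNb ha h
    rw [spreadSchedule_move hb hNb ha' h'] at e
    exact Fin.ext (Nat.ModEq.eq_of_lt_of_lt (Nat.ModEq.add_right_cancel' _ e) a'.2 a.2).symm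

variable {w : Fin n → Fin n → ℝ} {c : ℝ}

/-- The load on the way to the intermediate nodes. -/
theorem sum_digit_forward_le (hb : 0 < b) (hNb : N ≤ b ^ d) (hc : 0 ≤ c)
    (hw : ∀ i, ∑ j, w i j ≤ c) {q : ℕ} (hq : q < d) (α : ℕ) (a : Fin n) :
    (∑ i : Fin n, ∑ j, ∑ x ∈ Finset.range N,
      if x / b ^ q % b = α ∧ (i + x % b ^ q) % n = a then w i j else 0) ≤ b ^ (d - 1) * c := by
  calc _ = ∑ x ∈ Finset.range N, if x / b ^ q % b = α then
        ∑ i : Fin n, if (i + x % b ^ q) % n = a then ∑ j, w i j else 0 else 0 := by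
        rw [Finset.sum_congr rfl fun i _ => Finset.sum_comm, Finset.sum_comm]
        refine Finset.sum_congr rfl fun x _ => ?_
        split_ifs with h
        · refine Finset.sum_congr rfl fun i _ => ?_
          by_cases h' : (i + x % b ^ q) % n = a <;> simp [h, h']
        · simp [h]
    _ ≤ ∑ x ∈ Finset.range N, if x / b ^ q % b = α then c else 0 := by
        refine Finset.sum_le_sum fun x _ => ?_
        split_ifs with h
        · refine Finset.sum_ite_le_of_subsingleton _ _ (fun i _ i' _ h h' => ?_) hc hw
          exact Fin.ext (Nat.ModEq.eq_of_lt_of_lt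
            (Nat.ModEq.add_right_cancel' _ (h.trans h'.symm)) i.2 i'.2)
        · exact le_rfl
    _ ≤ b ^ (d - 1) * c := by
        rw [← Finset.sum_filter, Finset.sum_const, nsmul_eq_mul]
        exact mul_le_mul_of_nonneg_right (by exact_mod_cast card_filter_digit_le hb hNb hq α) hc

/-- The load on the way from the intermediate nodes. -/
theorem sum_digit_backward_le (hb : 0 < b) (hNb : N ≤ b ^ d) (hN : n ∣ N) (hc : 0 ≤ c)
    (hw₀ : ∀ i j, 0 ≤ w i j) (hw : ∀ j, ∑ i, w i j ≤ c) {q : ℕ} (hq : q < d) (α : ℕ) (a : Fin n) :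
    (∑ i : Fin n, ∑ j : Fin n, ∑ x ∈ Finset.range N,
      if remainingDistance n N i j x / b ^ q % b = α ∧
        (i + x + remainingDistance n N i j x % b ^ q) % n = a then w i j else 0) ≤
      b ^ (d - 1) * c := by
  classical
  -- Reindex by the remaining distance `y`. A unit at node `a` that has completed the digits of `y`
  -- below `q` still has to travel `b ^ q * (y / b ^ q)`. So `a` and `y` determine the destination
  -- `j`, and for each `y` only one column contributes.
  have step : ∀ i j : Fin n, (∑ x ∈ Finset.range N,
      if remainingDistance n N i j x / b ^ q % b = α ∧
        (i + x + remainingDistance n N i j x % b ^ q) % n = a then w i j else 0) ≤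
      ∑ y ∈ Finset.range N,
        if y / b ^ q % b = α ∧ (a + b ^ q * (y / b ^ q)) % n = j then w i j else 0 := by
    intro i j
    calc _ ≤ ∑ x ∈ Finset.range N, (fun y => if y / b ^ q % b = α ∧
            (a + b ^ q * (y / b ^ q)) % n = j then w i j else 0) (remainingDistance n N i j x) := by
          refine Finset.sum_le_sum fun x hx => ?_
          dsimp only
          split_ifs with h₁ h₂ h₂
          · exact le_rfl
          · refine absurd ⟨h₁.1, ?_⟩ h₂
            rw [← h₁.2, Nat.mod_add_mod, add_assoc, Nat.mod_add_div,
              remainingDistance_spec hN (Finset.mem_range.1 hx)]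
          · exact hw₀ i j
          · exact le_rfl
      _ = ∑ y ∈ (Finset.range N).image (remainingDistance n N i j), if y / b ^ q % b = α ∧
            (a + b ^ q * (y / b ^ q)) % n = j then w i j else 0 :=
          by rw [Finset.sum_image (injOn_remainingDistance _ _)]
      _ ≤ _ := by
          refine Finset.sum_le_sum_of_subset_of_nonneg ?_ fun y _ _ => ?_
          · intro y hy
            obtain ⟨x, hx, rfl⟩ := Finset.mem_image.1 hy
            have : x < N := Finset.mem_range.1 hx
            exact Finset.mem_range.2 (Nat.mod_lt _ (by omega))
          · split_ifs
            exacts [hw₀ i j, le_rfl]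
  calc _ ≤ ∑ i : Fin n, ∑ j : Fin n, ∑ y ∈ Finset.range N,
        if y / b ^ q % b = α ∧ (a + b ^ q * (y / b ^ q)) % n = j then w i j else 0 :=
        Finset.sum_le_sum fun i _ => Finset.sum_le_sum fun j _ => step i j
    _ = ∑ y ∈ Finset.range N, if y / b ^ q % b = α then
        ∑ j : Fin n, if (a + b ^ q * (y / b ^ q)) % n = j then ∑ i, w i j else 0 else 0 := by
        rw [Finset.sum_comm, Finset.sum_congr rfl fun i _ => Finset.sum_comm, Finset.sum_comm]
        refine Finset.sum_congr rfl fun y _ => ?_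
        split_ifs with h
        · refine Finset.sum_congr rfl fun j _ => ?_
          by_cases h' : (a + b ^ q * (y / b ^ q)) % n = j <;> simp [h, h']
        · simp [h]
    _ ≤ ∑ x ∈ Finset.range N, if x / b ^ q % b = α then c else 0 := by
        refine Finset.sum_le_sum fun x _ => ?_
        split_ifs with h
        · exact Finset.sum_ite_le_of_subsingleton _ _
            (fun i _ i' _ h h' => Fin.ext (h.symm.trans h')) hc hw
        · exact le_rfl
    _ ≤ b ^ (d - 1) * c := by
        rw [← Finset.sum_filter, Finset.sum_const, nsmul_eq_mul]
        exact mul_le_mul_of_nonneg_right (by exact_mod_cast card_filter_digit_le hb hNb hq α) hc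

/-- The time `s` determines the copy `k = s % m`, the digit position `q` and the digit value `α`. At
most `b ^ (d - 1)` distances have this digit, and each of them brings at most `β / (N * m)` to a
node; `hβ` says that the product is at most one. -/
theorem spreadSchedule_load_le (hb : 0 < b) (hNb : N ≤ b ^ d) (hN : n ∣ N) {β : ℝ}
    (hD : SumsAtMost D β) (hβ : b ^ (d - 1) * β ≤ N * m) (s : ℕ) (a c : Fin n) (hac : a ≠ c) :
    load (spreadSchedule b d m N D).makespan (spreadSchedule b d m N D).flow s a c ≤ 1 := by
  classical
  have hA : ∀ i j, 0 ≤ (D i j : ℝ) / (N * m) := fun i j => by positivity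
  have hβ₀ : 0 ≤ β := (Finset.sum_nonneg fun j _ => NNRat.cast_nonneg (D a j)).trans (hD.1 a)
  have hc₀ : 0 ≤ β / (N * m) := by positivity
  have hr : ∀ i, ∑ j, (D i j : ℝ) / (N * m) ≤ β / (N * m) := fun i => by
    rw [← Finset.sum_div]
    exact div_le_div_of_nonneg_right (hD.1 i) (by positivity)
  have hcol : ∀ j, ∑ i, (D i j : ℝ) / (N * m) ≤ β / (N * m) := fun j => by
    rw [← Finset.sum_div]
    exact div_le_div_of_nonneg_right (hD.2 j) (by positivity)
  have hfin : (b : ℝ) ^ (d - 1) * (β / (N * m)) ≤ 1 := by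
    rw [← mul_div_assoc]
    exact div_le_one_of_le₀ hβ (by positivity)
  rw [spreadSchedule_load_eq]
  set q := s / m / b with hq
  set α := s / m % b with hα
  have step : ∀ i j : Fin n, ∀ x ∈ Finset.range N, (∑ k ∈ Finset.range m,
      if Uses (fun r : Fin (2 * d * b * m + 1 + k + 1) =>
        (spreadBundle b d m N D i j x).position k r) s a c then (D i j : ℝ) / (N * m) else 0) ≤
      if q < d + d ∧ pairDigit b d x (remainingDistance n N i j x) q = α ∧
        (i + pairPrefix b d x (remainingDistance n N i j x) q) % n = a
        then (D i j : ℝ) / (N * m) else 0 := by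
    intro i j x hx
    have key : ∀ k ∈ Finset.range m, Uses (fun r : Fin (2 * d * b * m + 1 + k + 1) =>
        (spreadBundle b d m N D i j x).position k r) s a c → k = s % m ∧ q < d + d ∧
          pairDigit b d x (remainingDistance n N i j x) q = α ∧
          (i + pairPrefix b d x (remainingDistance n N i j x) q) % n = a := by
      intro k hk hu
      obtain ⟨h₁, h₂⟩ := hu.position
      obtain ⟨e₁, e₂, e₃, e₄, -⟩ := spreadBundle_step (D := D) (i := i) (j := j) hb hNb
        (Finset.mem_range.1 hx) (Finset.mem_range.1 hk) s (by rw [h₁, h₂]; exact hac)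
      refine ⟨e₁, e₂, e₃, ?_⟩
      rw [← h₁, e₄]
      rfl
    split_ifs with h
    · exact Finset.sum_ite_le_of_subsingleton _ _
        (fun k hk k' hk' h h' => (key k hk h).1.trans (key k' hk' h').1.symm) (hA i j)
        fun _ => le_rfl
    · exact (Finset.sum_eq_zero fun k hk => if_neg fun hu => h (key k hk hu).2).le
  refine (Finset.sum_le_sum fun i _ => Finset.sum_le_sum fun j _ =>
    Finset.sum_le_sum (step i j)).trans (le_trans ?_ hfin)
  by_cases hqd : q < d
  · simp only [pairDigit, pairPrefix, if_pos hqd, show q < d + d by omega, true_and]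
    exact sum_digit_forward_le hb hNb hc₀ hr hqd α a
  · by_cases hqd' : q < d + d
    · simp only [pairDigit, pairPrefix, if_neg hqd, hqd', true_and, ← add_assoc]
      exact sum_digit_backward_le hb hNb hN hc₀ hA hcol (by omega) α a
    · simp only [hqd', false_and, if_false, Finset.sum_const_zero]
      positivity

/-- Equality, not just `≥`, is what allows the average completion time to be bounded by the
makespan. -/
theorem spreadSchedule_delivered (hb : 0 < b) (hNb : N ≤ b ^ d) (hN : n ∣ N) (hN₀ : 0 < N)
    (hm : 0 < m) (i j : Fin n) :
    ∑ t ∈ Finset.Icc 1 (spreadSchedule b d m N D).makespan,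
      delivered (spreadSchedule b d m N D).flow i j t = D i j := by
  classical
  have := spreadSchedule_sum_flow (b := b) (d := d) (m := m) (N := N) (D := D)
    fun t p => if p 0 = i ∧ p (Fin.last t) = j then 1 else 0
  simp only [ite_mul, one_mul, zero_mul] at this
  have hpos : ∀ i' j' : Fin n, (∑ x ∈ Finset.range N, ∑ k ∈ Finset.range m,
      if (spreadBundle b d m N D i' j' x).position k (0 : Fin (2 * d * b * m + 1 + k + 1)) = i ∧
        (spreadBundle b d m N D i' j' x).position k (Fin.last (2 * d * b * m + 1 + k)) = j
      then (D i' j' : ℝ) / (N * m) else 0) = if i' = i ∧ j' = j then (D i' j' : ℝ) else 0 := by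
    intro i' j'
    rw [Finset.sum_congr rfl fun x hx => Finset.sum_congr rfl fun k hk => by
      rw [Fin.val_zero, spreadBundle_position_zero, Fin.val_last,
        spreadBundle_position_last hb hNb hN (Finset.mem_range.1 hx) (Finset.mem_range.1 hk)
          (by omega)]]
    simp only [Finset.sum_const, Finset.card_range, nsmul_eq_mul]
    split_ifs
    · have : (0 : ℝ) < N := by exact_mod_cast hN₀
      have : (0 : ℝ) < m := by exact_mod_cast hm
      field_simp
    · simp
  simp only [hpos] at this
  rw [Finset.sum_eq_single i, Finset.sum_eq_single j] at this
  · rw [if_pos ⟨rfl, rfl⟩] at this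
    rw [← this]
    unfold delivered
    refine Finset.sum_congr rfl fun t _ => Finset.sum_congr rfl fun p _ => ?_
    congr
  · intro j' _ h
    simp [h]
  · simp
  · intro i' _ h
    simp [h]
  · simp

theorem spreadSchedule_isIntegralRouting (hb : 0 < b) (hNb : N ≤ b ^ d) (hN : n ∣ N)
    (hN₀ : 0 < n → 0 < N) (hm : 0 < m) {β : ℝ} (hD : SumsAtMost D β)
    (hβ : b ^ (d - 1) * β ≤ N * m) :
    IsIntegralRouting D (spreadSchedule b d m N D).makespan (spreadSchedule b d m N D).flow := by
  refine ⟨⟨fun t p => ?_, spreadSchedule_load_le hb hNb hN hD hβ, fun i j =>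
    (spreadSchedule_delivered hb hNb hN (hN₀ i.pos) hm i j).ge⟩,
    spreadSchedule_isIntegralFlow hb hNb⟩
  refine List.sum_nonneg fun r hr => ?_
  obtain ⟨B, -, rfl⟩ := List.mem_map.1 hr
  refine Finset.sum_nonneg fun k _ => ?_
  split_ifs
  exacts [by positivity, le_rfl]

end Spread

/-- A routing that delivers exactly what is demanded has an average completion time of at most its
makespan. -/
theorem avgCompletionTime_le {n T : ℕ} {D : Matrix (Fin n) (Fin n) NNRat} {f : TimedFlow n}
    (hf : ∀ t p, 0 ≤ f t p)
    (h : ∀ i j, ∑ t ∈ Finset.Icc 1 T, delivered f i j t = D i j) :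
    avgCompletionTime D T f ≤ T := by
  classical
  refine div_le_of_le_mul₀ (Finset.sum_nonneg fun i _ => Finset.sum_nonneg fun j _ =>
    NNRat.cast_nonneg _) (Nat.cast_nonneg _) ?_
  simp only [← h, Finset.mul_sum]
  rw [totalCompletionTime, Finset.sum_comm]
  refine Finset.sum_le_sum fun i _ => ?_
  rw [Finset.sum_comm]
  refine Finset.sum_le_sum fun j _ => Finset.sum_le_sum fun t ht =>
    mul_le_mul_of_nonneg_right (by exact_mod_cast (Finset.mem_Icc.1 ht).2) ?_
  refine Finset.sum_nonneg fun p _ => ?_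
  split_ifs
  exacts [hf t p, le_rfl]

/-! ## The lower bound for uniform demands -/

section LowerBound

variable {n T : ℕ} {f : TimedFlow n}

open Classical in
/-- The node that receives the physical flow out of `a` at time `s` (or `a` if there is none). -/
noncomputable def nextNode (T : ℕ) (f : TimedFlow n) (s : ℕ) (a : Fin n) : Fin n :=
  if h : ∃ b, a ≠ b ∧ 0 < load T f s a b then h.choose else a

/-- The nodes that flow from `i` can reach by time `s` with at most `h` physical hops. -/
noncomputable def reachable (T : ℕ) (f : TimedFlow n) (i : Fin n) : ℕ → ℕ → Finset (Fin n)
  | 0, _ => {i}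
  | s + 1, 0 => reachable T f i s 0
  | s + 1, h + 1 => reachable T f i s (h + 1) ∪ (reachable T f i s h).image (nextNode T f s)

/-- The recursion of `reachable` is Pascal's rule, so the cardinality is at most the number of
subsets of at most `h` of `s` steps. The right side is the exponential-moment bound for this partial
binomial sum, with `z` free to be tuned later, and it passes through the recursion directly. -/
theorem card_reachable_le (i : Fin n) {z : ℝ} (hz : 1 ≤ z) (s h : ℕ) :
    ((reachable T f i s h).card : ℝ) ≤ (1 + 1 / z) ^ s * z ^ h := by
  have hz₀ : 0 < z := by linarith
  have h1 : 1 ≤ 1 + 1 / z := by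
    have : 0 < 1 / z := by positivity
    linarith
  induction s generalizing h with
  | zero => simpa [reachable] using one_le_pow₀ hz
  | succ s ih =>
    cases h with
    | zero =>
      refine (ih 0).trans ?_
      simpa using pow_le_pow_right₀ h1 (Nat.le_succ s)
    | succ h =>
      have hc : ((reachable T f i (s + 1) (h + 1)).card : ℝ) ≤
          (reachable T f i s (h + 1)).card + (reachable T f i s h).card := by
        exact_mod_cast (Finset.card_union_le _ _).trans
          (Nat.add_le_add_left Finset.card_image_le _)
      calc _ ≤ _ := hc
        _ ≤ (1 + 1 / z) ^ s * z ^ (h + 1) + (1 + 1 / z) ^ s * z ^ h := add_le_add (ih _) (ih _)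
        _ = (1 + 1 / z) ^ (s + 1) * z ^ (h + 1) := by
          have : 1 / z * z = 1 := by field_simp
          rw [pow_succ, pow_succ]
          generalize (1 + 1 / z) ^ s = P
          linear_combination -(P * z ^ h) * this

theorem reachable_subset (i : Fin n) {s s' : ℕ} (hs : s ≤ s') (h : ℕ) :
    reachable T f i s h ⊆ reachable T f i s' h := by
  induction hs with
  | refl => exact subset_rfl
  | step _ ih =>
    refine ih.trans ?_
    cases h with
    | zero => exact subset_rfl
    | succ h => exact Finset.subset_union_left

/-- The number of physical edges of a path. -/
def pathHops {t : ℕ} (p : Fin (t + 1) → Fin n) : ℕ :=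
  (Finset.univ.filter fun r : Fin t => p r.castSucc ≠ p r.succ).card

/-- By integrality all flow leaving a node at a given time enters the same node, namely `nextNode`.
A path carrying flow thus only chooses when to hop, not where to. -/
theorem mem_reachable (hf : IsIntegralFlow T f) {i : Fin n} {t : ℕ} (p : Fin (t + 1) → Fin n)
    (h0 : p 0 = i)
    (hp : ∀ r : Fin t, p r.castSucc ≠ p r.succ → 0 < load T f r (p r.castSucc) (p r.succ)) :
    ∀ h, pathHops p ≤ h → p (Fin.last t) ∈ reachable T f i t h := by
  induction t with
  | zero => exact fun h _ => by simp [reachable, ← h0]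
  | succ t ih =>
    intro h hh
    have hcount : pathHops p = pathHops (fun r : Fin (t + 1) => p r.castSucc) +
        if p (Fin.last t).castSucc ≠ p (Fin.last t).succ then 1 else 0 := by
      simp only [pathHops, Finset.card_filter]
      rw [Fin.sum_univ_castSucc]
      rfl
    have ih' := ih (fun r => p r.castSucc) h0 fun r hr => hp r.castSucc hr
    split_ifs at hcount with hl
    · obtain ⟨h, rfl⟩ : ∃ h', h = h' + 1 := ⟨h - 1, by omega⟩
      have hpos := hp (Fin.last t) hl
      have hnext : nextNode T f t (p (Fin.last t).castSucc) = p (Fin.last t).succ := by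
        have hex : ∃ b, p (Fin.last t).castSucc ≠ b ∧ 0 < load T f t (p (Fin.last t).castSucc) b :=
          ⟨_, hl, hpos⟩
        rw [nextNode, dif_pos hex]
        exact hf.out_unique _ _ _ _ hex.choose_spec.1 hl hex.choose_spec.2 hpos
      refine Finset.mem_union_right _ (Finset.mem_image.2 ⟨_, ih' h (by omega), hnext⟩)
    · rw [not_not] at hl
      refine reachable_subset i (Nat.le_succ t) h ?_
      have := ih' h (by omega)
      rw [hl] at this
      exact this

theorem le_load {t s : ℕ} (hf : ∀ t p, 0 ≤ f t p) (ht : t ∈ Finset.Icc 1 T)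
    {p : Fin (t + 1) → Fin n} {a b : Fin n} (hp : Uses p s a b) : f t p ≤ load T f s a b := by
  classical
  have hnn : ∀ t, ∀ p : Fin (t + 1) → Fin n, 0 ≤ if Uses p s a b then f t p else 0 := by
    intro t p
    split_ifs
    exacts [hf t p, le_rfl]
  calc f t p = if Uses p s a b then f t p else 0 := (if_pos hp).symm
    _ ≤ ∑ p : Fin (t + 1) → Fin n, if Uses p s a b then f t p else 0 :=
      Finset.single_le_sum (fun p _ => hnn t p) (Finset.mem_univ p)
    _ ≤ ∑ t ∈ Finset.Icc 1 T, ∑ p : Fin (t + 1) → Fin n, if Uses p s a b then f t p else 0 :=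
      Finset.single_le_sum (f := fun t => ∑ p : Fin (t + 1) → Fin n,
        if Uses p s a b then f t p else 0) (fun t _ => Finset.sum_nonneg fun p _ => hnn t p) ht
    _ = load T f s a b := by
      unfold load
      refine Finset.sum_congr rfl fun t _ => Finset.sum_congr rfl fun p _ => ?_
      congr

/-- The total number of hops by time `σ` is limited by the capacities. -/
theorem sum_pathHops_le {D : Matrix (Fin n) (Fin n) NNRat} (hf : IsIntegralRouting D T f) {σ : ℕ}
    (hσ : σ ≤ T) :
    ∑ t ∈ Finset.Icc 1 σ, ∑ p : Fin (t + 1) → Fin n, f t p * pathHops p ≤ n * σ := by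
  classical
  obtain ⟨⟨hnn, hcap, -⟩, hint⟩ := hf
  have hhops : ∀ t ∈ Finset.Icc 1 σ, ∀ p : Fin (t + 1) → Fin n, (pathHops p : ℝ) ≤
      ∑ s ∈ Finset.range σ, ∑ a, ∑ b, if a ≠ b ∧ Uses p s a b then 1 else 0 := by
    intro t ht p
    have ht := (Finset.mem_Icc.1 ht).2
    calc (pathHops p : ℝ) = ∑ r : Fin t, if p r.castSucc ≠ p r.succ then 1 else 0 := by
          simp [pathHops, Finset.card_filter]
      _ ≤ ∑ r : Fin t, ∑ a, ∑ b, if a ≠ b ∧ Uses p r a b then (1 : ℝ) else 0 := by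
          refine Finset.sum_le_sum fun r _ => ?_
          have hn : ∀ a b, (0 : ℝ) ≤ if a ≠ b ∧ Uses p r a b then 1 else 0 := by
            intro a b
            split_ifs <;> norm_num
          split_ifs with h
          · calc (1 : ℝ) = if p r.castSucc ≠ p r.succ ∧ Uses p r (p r.castSucc) (p r.succ)
                  then 1 else 0 := (if_pos ⟨h, r, rfl, rfl, rfl⟩).symm
              _ ≤ ∑ b, if p r.castSucc ≠ b ∧ Uses p r (p r.castSucc) b then (1 : ℝ) else 0 :=
                Finset.single_le_sum (f := fun b => if p r.castSucc ≠ b ∧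
                  Uses p r (p r.castSucc) b then (1 : ℝ) else 0) (fun b _ => hn _ b)
                  (Finset.mem_univ _)
              _ ≤ _ := Finset.single_le_sum (f := fun a => ∑ b, if a ≠ b ∧ Uses p r a b
                  then (1 : ℝ) else 0) (fun a _ => Finset.sum_nonneg fun b _ => hn a b)
                  (Finset.mem_univ _)
          · exact Finset.sum_nonneg fun a _ => Finset.sum_nonneg fun b _ => hn a b
      _ = ∑ s ∈ Finset.range t, ∑ a, ∑ b, if a ≠ b ∧ Uses p s a b then (1 : ℝ) else 0 :=
          Fin.sum_univ_eq_sum_range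
            (fun s => ∑ a, ∑ b, if a ≠ b ∧ Uses p s a b then (1 : ℝ) else 0) t
      _ ≤ _ := by
          refine Finset.sum_le_sum_of_subset_of_nonneg (Finset.range_mono ht) fun s _ _ => ?_
          refine Finset.sum_nonneg fun a _ => Finset.sum_nonneg fun b _ => ?_
          split_ifs <;> norm_num
  -- Only one edge out of `a` has positive load at time `s`, and it carries at most one unit.
  -- Summing over the nodes and over `σ` steps gives `n * σ`.
  have hout : ∀ s a, (∑ b, if a ≠ b then load T f s a b else 0) ≤ 1 := by
    intro s a
    have : ∀ b, (if a ≠ b then load T f s a b else 0) =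
        if a ≠ b ∧ 0 < load T f s a b then (if a ≠ b then load T f s a b else 0) else 0 := by
      intro b
      by_cases hb : a ≠ b
      · have h0 : 0 ≤ load T f s a b := by
          refine Finset.sum_nonneg fun t _ => Finset.sum_nonneg fun p _ => ?_
          split_ifs
          exacts [hnn t p, le_rfl]
        rcases h0.eq_or_lt with h0 | h0
        · simp [← h0]
        · simp [hb, h0]
      · simp [hb]
    rw [Finset.sum_congr rfl fun b _ => this b]
    refine Finset.sum_ite_le_of_subsingleton _ _ (fun b _ b' _ h h' =>
      hint.out_unique s a b b' h.1 h'.1 h.2 h'.2) zero_le_one fun b => ?_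
    split_ifs with hb
    exacts [hcap s a b hb, zero_le_one]
  calc _ ≤ ∑ t ∈ Finset.Icc 1 σ, ∑ p : Fin (t + 1) → Fin n, f t p *
        ∑ s ∈ Finset.range σ, ∑ a, ∑ b, (if a ≠ b ∧ Uses p s a b then 1 else 0) :=
        Finset.sum_le_sum fun t ht => Finset.sum_le_sum fun p _ =>
          mul_le_mul_of_nonneg_left (hhops t ht p) (hnn t p)
    _ = ∑ s ∈ Finset.range σ, ∑ a, ∑ b, if a ≠ b then ∑ t ∈ Finset.Icc 1 σ,
          ∑ p : Fin (t + 1) → Fin n, if Uses p s a b then f t p else 0 else 0 := by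
        simp only [Finset.mul_sum]
        rw [Finset.sum_congr rfl fun t _ => Finset.sum_comm, Finset.sum_comm]
        refine Finset.sum_congr rfl fun s _ => ?_
        rw [Finset.sum_congr rfl fun t _ => Finset.sum_comm, Finset.sum_comm]
        refine Finset.sum_congr rfl fun a _ => ?_
        rw [Finset.sum_congr rfl fun t _ => Finset.sum_comm, Finset.sum_comm]
        refine Finset.sum_congr rfl fun b _ => ?_
        by_cases hb : a = b <;> simp [hb]
    _ ≤ ∑ s ∈ Finset.range σ, ∑ a, ∑ b, if a ≠ b then load T f s a b else 0 := by
        refine Finset.sum_le_sum fun s _ => Finset.sum_le_sum fun a _ =>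
          Finset.sum_le_sum fun b _ => ?_
        split_ifs
        · unfold load
          refine (Finset.sum_le_sum_of_subset_of_nonneg
            (Finset.Icc_subset_Icc_right hσ) fun t _ _ => ?_).trans (le_of_eq ?_)
          · refine Finset.sum_nonneg fun p _ => ?_
            split_ifs
            exacts [hnn t p, le_rfl]
          · refine Finset.sum_congr rfl fun t _ => Finset.sum_congr rfl fun p _ => ?_
            congr
        · exact le_rfl
    _ ≤ ∑ s ∈ Finset.range σ, ∑ a : Fin n, 1 :=
        Finset.sum_le_sum fun s _ => Finset.sum_le_sum fun a _ => hout s a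
    _ = n * σ := by simp [mul_comm]

/-- Not much of a demand of `δ` for every pair can be delivered by time `σ`: either few nodes are
reached, or many hops are made. -/
theorem sum_min_delivered_le {D : Matrix (Fin n) (Fin n) NNRat} (hf : IsIntegralRouting D T f)
    {σ : ℕ} (hσ : σ ≤ T) {z : ℝ} (hz : 1 ≤ z) (h : ℕ) {δ : ℝ} (hδ : 0 ≤ δ) :
    ∑ i, ∑ j, min δ (∑ t ∈ Finset.Icc 1 σ, delivered f i j t) ≤
      n * δ * ((1 + 1 / z) ^ σ * z ^ h) + n * σ / (h + 1) := by
  classical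
  have hnn := hf.1.nonneg
  have hh : (0 : ℝ) < h + 1 := by positivity
  have hterm : ∀ i j, ∀ t, ∀ p : Fin (t + 1) → Fin n,
      0 ≤ if p 0 = i ∧ p (Fin.last t) = j then f t p * pathHops p else 0 := by
    intro i j t p
    split_ifs
    exacts [mul_nonneg (hnn t p) (Nat.cast_nonneg _), le_rfl]
  -- A reachable node is charged its full demand `δ`. For any other node, every path with positive
  -- flow has at least `h + 1` hops, so the delivered amount is at most the hop volume divided by `h
  -- + 1`.
  have hpair : ∀ i j, min δ (∑ t ∈ Finset.Icc 1 σ, delivered f i j t) ≤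
      (if j ∈ reachable T f i σ h then δ else 0) + (∑ t ∈ Finset.Icc 1 σ,
        ∑ p : Fin (t + 1) → Fin n,
          if p 0 = i ∧ p (Fin.last t) = j then f t p * pathHops p else 0) / (h + 1) := by
    intro i j
    split_ifs with hj
    · have : (0 : ℝ) ≤ (∑ t ∈ Finset.Icc 1 σ, ∑ p : Fin (t + 1) → Fin n,
          if p 0 = i ∧ p (Fin.last t) = j then f t p * pathHops p else 0) / (h + 1) :=
        div_nonneg (Finset.sum_nonneg fun t _ => Finset.sum_nonneg fun p _ => hterm i j t p) hh.le
      linarith [min_le_left δ (∑ t ∈ Finset.Icc 1 σ, delivered f i j t)]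
    · refine (min_le_right _ _).trans ?_
      rw [zero_add, le_div_iff₀ hh, Finset.sum_mul]
      refine Finset.sum_le_sum fun t ht => ?_
      rw [delivered, Finset.sum_mul]
      refine Finset.sum_le_sum fun p _ => ?_
      by_cases hij : p 0 = i ∧ p (Fin.last t) = j
      · rw [if_pos hij, if_pos hij]
        rcases (hnn t p).eq_or_lt with h0 | h0
        · simp [← h0]
        · refine mul_le_mul_of_nonneg_left ?_ h0.le
          by_contra hlt
          have hlt : pathHops p ≤ h := by
            have : pathHops p < h + 1 := by exact_mod_cast not_le.1 hlt
            omega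
          have ht' := Finset.mem_Icc.1 ht
          refine hj (reachable_subset i ht'.2 h ?_)
          rw [← hij.2]
          exact mem_reachable hf.2 p hij.1 (fun r _ => h0.trans_le
            (le_load hnn (Finset.mem_Icc.2 ⟨ht'.1, ht'.2.trans hσ⟩) ⟨r, rfl, rfl, rfl⟩)) h hlt
      · rw [if_neg hij, if_neg hij, zero_mul]
  calc _ ≤ ∑ i, ∑ j, ((if j ∈ reachable T f i σ h then δ else 0) + (∑ t ∈ Finset.Icc 1 σ,
        ∑ p : Fin (t + 1) → Fin n,
          if p 0 = i ∧ p (Fin.last t) = j then f t p * pathHops p else 0) / (h + 1)) :=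
        Finset.sum_le_sum fun i _ => Finset.sum_le_sum fun j _ => hpair i j
    _ = ∑ i, (reachable T f i σ h).card * δ +
        (∑ t ∈ Finset.Icc 1 σ, ∑ p : Fin (t + 1) → Fin n, f t p * pathHops p) / (h + 1) := by
        simp only [Finset.sum_add_distrib, ← Finset.sum_div]
        congr 2
        · simp
        · rw [Finset.sum_congr rfl fun i _ => Finset.sum_comm, Finset.sum_comm]
          refine Finset.sum_congr rfl fun t _ => ?_
          rw [Finset.sum_congr rfl fun i _ => Finset.sum_comm, Finset.sum_comm]
          refine Finset.sum_congr rfl fun p _ => ?_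
          rw [Finset.sum_eq_single (p 0), Finset.sum_eq_single (p (Fin.last t))]
          · simp
          · intro j _ hj
            simp [hj.symm]
          · simp
          · intro i _ hi
            simp [hi.symm]
          · simp
    _ ≤ ∑ i : Fin n, (1 + 1 / z) ^ σ * z ^ h * δ + n * σ / (h + 1) := by
        refine add_le_add (Finset.sum_le_sum fun i _ =>
          mul_le_mul_of_nonneg_right (card_reachable_le i hz σ h) hδ) ?_
        exact div_le_div_of_nonneg_right (sum_pathHops_le hf hσ) hh.le
    _ = _ := by
        simp
        ring

/-- If at most three quarters of a uniform demand can be delivered by time `τ`, then both objectives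
are at least `(τ + 1) / 4`. -/
theorem uniform_lower_bound (hn : 0 < n) {B : NNRat} (hB : 0 < B)
    (hf : IsIntegralRouting (uniformDemand n B) T f) {τ h : ℕ} {z : ℝ} (hz : 1 ≤ z)
    (hτ : (B : ℝ) * ((1 + 1 / z) ^ τ * z ^ h) + n * τ / (h + 1) ≤ 3 / 4 * (n * B)) :
    ((τ : ℝ) + 1) / 4 ≤ T ∧
      ((τ : ℝ) + 1) / 4 ≤ avgCompletionTime (uniformDemand n B) T f := by
  have hn₀ : (0 : ℝ) < n := by exact_mod_cast hn
  have hB₀ : (0 : ℝ) < B := by exact_mod_cast hB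
  have hz₀ : 0 < z := by linarith
  set δ : ℝ := B / n with hδ
  have hδ₀ : 0 < δ := by positivity
  have hnδ : n * δ = B := by rw [hδ]; field_simp
  have hD : ∀ i j, ((uniformDemand n B i j : NNRat) : ℝ) = δ := fun i j => by
    simp [uniformDemand, hδ]
  have hsum : ∑ i : Fin n, ∑ j : Fin n, ((uniformDemand n B i j : NNRat) : ℝ) = n * B := by
    simp only [hD, Finset.sum_const, Finset.card_univ, Fintype.card_fin, nsmul_eq_mul, hnδ]
  have hdem := hf.1.demand
  simp only [hD] at hdem
  have hdel : ∀ i j t, 0 ≤ delivered f i j t := by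
    intro i j t
    refine Finset.sum_nonneg fun p _ => ?_
    split_ifs
    exacts [hf.1.nonneg t p, le_rfl]
  have hbound : ∀ σ ≤ T, σ ≤ τ →
      ∑ i, ∑ j, min δ (∑ t ∈ Finset.Icc 1 σ, delivered f i j t) ≤ 3 / 4 * (n * B) := by
    intro σ hσT hστ
    refine (sum_min_delivered_le hf hσT hz h hδ₀.le).trans (le_trans ?_ hτ)
    have h1 : 1 ≤ 1 + 1 / z := by
      have : 0 < 1 / z := by positivity
      linarith
    rw [hnδ]
    gcongr
  -- A horizon of at most `τ` would deliver the whole demand, more than the three quarters that are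
  -- possible.
  have hlt : τ < T := by
    by_contra hle
    have := hbound T le_rfl (not_lt.1 hle)
    simp only [min_eq_left (hdem _ _), Finset.sum_const, Finset.card_univ, Fintype.card_fin,
      nsmul_eq_mul, hnδ] at this
    have : 0 < n * (B : ℝ) := by positivity
    linarith
  have hlt' : (τ : ℝ) + 1 ≤ T := by exact_mod_cast hlt
  refine ⟨by linarith [(Nat.cast_nonneg τ : (0 : ℝ) ≤ τ)], ?_⟩
  -- What is missing at time `τ` arrives at time `τ + 1` or later. The missing amount is at least a
  -- quarter of the total demand.
  have hlate : ∀ i j, ((τ : ℝ) + 1) * (δ - min δ (∑ t ∈ Finset.Icc 1 τ, delivered f i j t)) ≤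
      ∑ t ∈ Finset.Icc 1 T, (t : ℝ) * delivered f i j t := by
    intro i j
    have hsplit := Finset.sum_sdiff (f := fun t => delivered f i j t)
      (Finset.Icc_subset_Icc_right hlt.le : Finset.Icc 1 τ ⊆ Finset.Icc 1 T)
    have hrest : 0 ≤ ∑ t ∈ Finset.Icc 1 T \ Finset.Icc 1 τ, delivered f i j t :=
      Finset.sum_nonneg fun t _ => hdel i j t
    calc _ ≤ ((τ : ℝ) + 1) * ∑ t ∈ Finset.Icc 1 T \ Finset.Icc 1 τ, delivered f i j t := by
          refine mul_le_mul_of_nonneg_left ?_ (by positivity)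
          have := hdem i j
          rcases min_choice δ (∑ t ∈ Finset.Icc 1 τ, delivered f i j t) with h | h <;>
          · rw [h]
            linarith
      _ ≤ ∑ t ∈ Finset.Icc 1 T \ Finset.Icc 1 τ, (t : ℝ) * delivered f i j t := by
          rw [Finset.mul_sum]
          refine Finset.sum_le_sum fun t ht => mul_le_mul_of_nonneg_right ?_ (hdel i j t)
          simp only [Finset.mem_sdiff, Finset.mem_Icc, not_and, not_le] at ht
          exact_mod_cast ht.2 ht.1.1
      _ ≤ _ := Finset.sum_le_sum_of_subset_of_nonneg Finset.sdiff_subset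
          fun t _ _ => mul_nonneg (Nat.cast_nonneg _) (hdel i j t)
  have htotal : ((τ : ℝ) + 1) * (n * B - 3 / 4 * (n * B)) ≤ totalCompletionTime T f := by
    calc _ ≤ ((τ : ℝ) + 1) *
          (n * B - ∑ i, ∑ j, min δ (∑ t ∈ Finset.Icc 1 τ, delivered f i j t)) :=
          mul_le_mul_of_nonneg_left (by linarith [hbound τ hlt.le le_rfl]) (by positivity)
      _ = ∑ i, ∑ j,
          ((τ : ℝ) + 1) * (δ - min δ (∑ t ∈ Finset.Icc 1 τ, delivered f i j t)) := by
          simp only [← Finset.mul_sum, Finset.sum_sub_distrib, Finset.sum_const, Finset.card_univ,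
            Fintype.card_fin, nsmul_eq_mul, hnδ]
      _ ≤ ∑ i, ∑ j, ∑ t ∈ Finset.Icc 1 T, (t : ℝ) * delivered f i j t :=
          Finset.sum_le_sum fun i _ => Finset.sum_le_sum fun j _ => hlate i j
      _ = totalCompletionTime T f := by
          rw [totalCompletionTime, Finset.sum_congr rfl fun i _ => Finset.sum_comm,
            Finset.sum_comm]
  rw [avgCompletionTime, hsum, le_div_iff₀ (by positivity)]
  linarith

theorem one_add_one_div_pow_le {z : ℝ} (hz : 0 < z) (τ : ℕ) :
    (1 + 1 / z) ^ τ ≤ Real.exp (τ / z) := by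
  calc (1 + 1 / z) ^ τ ≤ Real.exp (1 / z) ^ τ :=
        pow_le_pow_left₀ (by positivity) (by linarith [Real.add_one_le_exp (1 / z)]) τ
    _ = Real.exp (τ / z) := by rw [← Real.exp_nat_mul]; congr 1; ring

/-- Every integral routing of uniform demands has large makespan and average completion time. -/
theorem worstCaseRate_le (hn : 2 ≤ n) {B : NNRat} (hB : 0 < B)
    (hf : IsIntegralRouting (uniformDemand n B) T f) :
    1 / 128 * worstCaseRate n B ≤ T ∧
      1 / 128 * worstCaseRate n B ≤ avgCompletionTime (uniformDemand n B) T f := by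
  have hn₀ : (2 : ℝ) ≤ n := by exact_mod_cast hn
  have hB₀ : (0 : ℝ) < B := by exact_mod_cast hB
  have hnB : 2 * (B : ℝ) ≤ n * B := mul_le_mul_of_nonneg_right hn₀ hB₀.le
  have hlogn : 0 ≤ Real.log n := Real.log_nonneg (by linarith)
  have key : ∀ {τ h : ℕ} {z : ℝ}, 1 ≤ z →
      (B : ℝ) * ((1 + 1 / z) ^ τ * z ^ h) + n * τ / (h + 1) ≤ 3 / 4 * (n * B) →
      ((τ : ℝ) + 1) / 4 ≤ min (T : ℝ) (avgCompletionTime (uniformDemand n B) T f) :=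
    fun hz hτ => le_min_iff.2 (uniform_lower_bound (by omega) hB hf hz hτ)
  rw [← le_min_iff]
  set R := min (T : ℝ) (avgCompletionTime (uniformDemand n B) T f)
  -- Here `z = 1` and the reach at most doubles per step: `2 ^ τ ≤ n / 2` accounts for half of the
  -- demand. The hop limit `h` is so large that the hop term contributes at most a further quarter.
  have hlog : 1 / 8 * Real.log n ≤ R := by
    have hl : 1 ≤ Nat.log 2 n := Nat.log_pos one_lt_two hn
    have hpow : (2 : ℝ) ^ (Nat.log 2 n - 1) ≤ n / 2 := by
      have h₁ : (2 : ℝ) ^ (Nat.log 2 n) ≤ n := by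
        exact_mod_cast Nat.pow_log_le_self 2 (by omega)
      rw [show Nat.log 2 n = Nat.log 2 n - 1 + 1 by omega, pow_succ] at h₁
      linarith
    have hh := Nat.le_ceil (4 * ((Nat.log 2 n - 1 : ℕ) : ℝ) / B)
    rw [div_le_iff₀ hB₀] at hh
    have := key (τ := Nat.log 2 n - 1) (h := ⌈4 * ((Nat.log 2 n - 1 : ℕ) : ℝ) / B⌉₊) le_rfl ?_
    · rw [Nat.cast_sub hl, Nat.cast_one, sub_add_cancel] at this
      have hlt : (n : ℝ) ≤ 2 ^ (Nat.log 2 n + 1) := by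
        exact_mod_cast (Nat.lt_pow_succ_log_self one_lt_two n).le
      have h₂ := Real.log_le_log (by linarith) hlt
      rw [Real.log_pow] at h₂
      have h₃ : (1 : ℝ) ≤ Nat.log 2 n := by exact_mod_cast hl
      have h₄ : ((Nat.log 2 n + 1 : ℕ) : ℝ) * Real.log 2 ≤ (2 * Nat.log 2 n : ℝ) * 1 :=
        mul_le_mul (by push_cast; linarith) (by linarith [Real.log_two_lt_d9])
          (Real.log_nonneg one_le_two) (by positivity)
      linarith
    · have e : (1 + 1 / (1 : ℝ)) = 2 := by norm_num
      rw [e, one_pow, mul_one]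
      have h₁ : (B : ℝ) * 2 ^ (Nat.log 2 n - 1) ≤ B * (n / 2) :=
        mul_le_mul_of_nonneg_left hpow hB₀.le
      have h₂ : (n : ℝ) * ((Nat.log 2 n - 1 : ℕ) : ℝ) /
          (⌈4 * ((Nat.log 2 n - 1 : ℕ) : ℝ) / B⌉₊ + 1) ≤ n * (B / 4) := by
        rw [mul_div_assoc]
        refine mul_le_mul_of_nonneg_left ?_ (by linarith)
        rw [div_le_iff₀ (by positivity)]
        linarith
      linarith
  -- Here `h = 0`: all data except that from a node to itself makes at least one hop. The choice `z
  -- = 8 * τ + 1` keeps the reach factor below `exp (1 / 8) ≤ 8 / 7`, and `n ≥ 2` makes `8 / 7 * B +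
  -- n * B / 8` small enough.
  have hlin : 1 / 32 * (B : ℝ) ≤ R := by
    have hfl := Nat.floor_le (show 0 ≤ (B : ℝ) / 8 by positivity)
    have := key (τ := ⌊(B : ℝ) / 8⌋₊) (h := 0) (z := 8 * ⌊(B : ℝ) / 8⌋₊ + 1)
      (by linarith [(Nat.cast_nonneg ⌊(B : ℝ) / 8⌋₊ : (0 : ℝ) ≤ _)]) ?_
    · linarith [Nat.lt_floor_add_one ((B : ℝ) / 8)]
    · set τ := ⌊(B : ℝ) / 8⌋₊
      have h₁ : (1 + 1 / (8 * (τ : ℝ) + 1)) ^ τ ≤ 8 / 7 := by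
        refine (one_add_one_div_pow_le (by positivity) τ).trans ?_
        have h₂ : (τ : ℝ) / (8 * τ + 1) ≤ 1 / 8 := by
          rw [div_le_div_iff₀ (by positivity) (by norm_num)]
          linarith
        have h₃ := Real.add_one_le_exp (-(1 / 8 : ℝ))
        rw [Real.exp_neg] at h₃
        have h₄ : Real.exp (1 / 8) ≤ 8 / 7 := by
          have h₅ := Real.exp_pos (1 / 8)
          have h₆ := mul_le_mul_of_nonneg_right h₃ h₅.le
          rw [inv_mul_cancel₀ h₅.ne'] at h₆
          linarith
        exact (Real.exp_le_exp.2 h₂).trans h₄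
      have h₂ : (B : ℝ) * ((1 + 1 / (8 * (τ : ℝ) + 1)) ^ τ * (8 * (τ : ℝ) + 1) ^ 0) ≤
          B * (8 / 7) := by
        rw [pow_zero, mul_one]
        exact mul_le_mul_of_nonneg_left h₁ hB₀.le
      have h₃ : (n : ℝ) * τ ≤ n * (B / 8) := mul_le_mul_of_nonneg_left hfl (by linarith)
      rw [Nat.cast_zero, zero_add, div_one]
      linarith
  -- Here `z = B`, `h` is about `log n / (4 * log B)` and `τ` about `(h + 1) * B / 4`. The hop term
  -- and the reach term are then at most a quarter of the demand each.
  have hmid : 2 ≤ (B : ℝ) → 1 / 128 * (B * Real.log n / Real.log B) ≤ R := by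
    intro hB2
    have hlogB : 1 / 2 ≤ Real.log B := by
      have := Real.log_le_log two_pos hB2
      linarith [Real.log_two_gt_d9]
    set h := ⌊Real.log n / (4 * Real.log B)⌋₊ with hh
    have hle : h * (4 * Real.log B) ≤ Real.log n := by
      rw [← le_div_iff₀ (by positivity)]
      exact Nat.floor_le (by positivity)
    have hgt : Real.log n ≤ (h + 1) * (4 * Real.log B) := by
      rw [← div_le_iff₀ (by positivity)]
      exact (Nat.lt_floor_add_one _).le
    have hrate : B * Real.log n / Real.log B ≤ 4 * (h + 1) * (B : ℝ) := by
      rw [div_le_iff₀ (by linarith)]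
      have := mul_le_mul_of_nonneg_left hgt hB₀.le
      linarith
    -- For `h = 0` the rate is at most `4 * B`, so the linear bound suffices.
    rcases Nat.eq_zero_or_pos h with h0 | h0
    · rw [h0, Nat.cast_zero] at hrate
      linarith
    · have h1 : (1 : ℝ) ≤ h := by exact_mod_cast h0
      have hfl := Nat.floor_le (show 0 ≤ ((h : ℝ) + 1) * B / 4 by positivity)
      have := key (τ := ⌊((h : ℝ) + 1) * B / 4⌋₊) (h := h) (z := B) (by linarith) ?_
      · linarith [Nat.lt_floor_add_one (((h : ℝ) + 1) * B / 4)]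
      · set τ := ⌊((h : ℝ) + 1) * B / 4⌋₊
        have hτ : n * τ / ((h : ℝ) + 1) ≤ n * (B / 4) := by
          rw [mul_div_assoc]
          refine mul_le_mul_of_nonneg_left ?_ (by linarith)
          rw [div_le_iff₀ (by positivity)]
          linarith
        have hreach : (1 + 1 / (B : ℝ)) ^ τ * (B : ℝ) ^ h ≤ n / 4 := by
          have e₁ : (B : ℝ) ^ h = Real.exp (h * Real.log B) := by
            rw [Real.exp_nat_mul, Real.exp_log hB₀]
          -- `(h + 1) / 4 ≤ h / 2` because `h ≥ 1`, and `log B ≥ 1 / 2`.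
          have e₂ : (τ : ℝ) / B ≤ h * Real.log B := by
            rw [div_le_iff₀ hB₀]
            have h₁ : ((h : ℝ) + 1) * B / 4 ≤ h * (1 / 2) * B := by nlinarith
            have h₂ : h * (1 / 2) * (B : ℝ) ≤ h * Real.log B * B := by gcongr
            linarith
          -- Since `h ≥ 1`, `log n ≥ 4 * log B ≥ 4 * log 2`; so `n ≥ 16` and the square root of `n`
          -- is at most `n / 4`.
          have e₃ : Real.log n / 2 + Real.log 4 ≤ Real.log n := by
            have h₁ : Real.log 4 = 2 * Real.log 2 := by
              rw [show (4 : ℝ) = 2 ^ 2 by norm_num, Real.log_pow]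
              norm_num
            have h₂ := Real.log_le_log two_pos hB2
            nlinarith
          calc (1 + 1 / (B : ℝ)) ^ τ * (B : ℝ) ^ h
              ≤ Real.exp (h * Real.log B) * Real.exp (h * Real.log B) := by
                rw [e₁]
                exact mul_le_mul_of_nonneg_right ((one_add_one_div_pow_le hB₀ τ).trans
                  (Real.exp_le_exp.2 e₂)) (Real.exp_pos _).le
            _ ≤ Real.exp (Real.log n - Real.log 4) := by
                rw [← Real.exp_add]
                exact Real.exp_le_exp.2 (by linarith)
            _ = n / 4 := by
                rw [Real.exp_sub, Real.exp_log (by linarith), Real.exp_log (by norm_num)]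
        have := mul_le_mul_of_nonneg_left hreach hB₀.le
        linarith
  have hR : 0 ≤ R := le_trans (by positivity) hlin
  rw [worstCaseRate, mul_comm, ← le_div_iff₀ (by norm_num)]
  refine max_le ?_ (max_le ?_ ?_)
  · linarith
  · split_ifs with h2
    · linarith [hmid h2]
    · linarith
  · linarith

end LowerBound

/-! ## The algorithm and its guarantee -/

section Algorithm

variable {n : ℕ} (D : Matrix (Fin n) (Fin n) NNRat)

/-- An integer upper bound for `n * D i j`. -/
def entryEstimate (i j : Fin n) : ℕ := n * (D i j).num / (D i j).den + 1

/-- An integer upper bound for `n` times the row sums and column sums. -/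
def degreeEstimate : ℕ :=
  Finset.univ.sup fun i => max (∑ j, entryEstimate D i j) (∑ j, entryEstimate D j i)

/-- An integer upper bound for the row sums and column sums. -/
def demandBound : ℕ := degreeEstimate D / n + 1

/-- The base in which distances are written. -/
def routeBase : ℕ := min (demandBound D) n

/-- The number of digits of distances. -/
def routeDigits : ℕ := Nat.clog (routeBase D) n

/-- The number of random distances: the largest multiple of `n` with the given number of digits. -/
def routeModulus : ℕ := n * (routeBase D ^ routeDigits D / n)

/-- The length of the time slots. -/
def routeSlot : ℕ := 2 * demandBound D / routeBase D + 1

/-- Two-phase routing, with base, number of digits and slot length adapted to the demands. -/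
def spreadAlgorithm (n : ℕ) (D : Matrix (Fin n) (Fin n) NNRat) : Schedule n :=
  spreadSchedule (routeBase D) (routeDigits D) (routeSlot D) (routeModulus D) D

variable {D}

theorem mul_le_entryEstimate (i j : Fin n) : (n : ℝ) * D i j ≤ entryEstimate D i j := by
  have h : n * (D i j).num ≤ (D i j).den * entryEstimate D i j :=
    (Nat.lt_mul_div_succ _ (D i j).den_pos).le
  have h' : (n : ℝ) * (D i j).num ≤ (D i j).den * entryEstimate D i j := by exact_mod_cast h
  have hd : (0 : ℝ) < (D i j).den := by exact_mod_cast (D i j).den_pos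
  rw [NNRat.cast_def, ← mul_div_assoc, div_le_iff₀ hd]
  linarith

theorem entryEstimate_le (i j : Fin n) : (entryEstimate D i j : ℝ) ≤ n * D i j + 1 := by
  rw [entryEstimate, NNRat.cast_def, ← mul_div_assoc]
  push_cast
  refine add_le_add_left ?_ 1
  exact_mod_cast Nat.cast_div_le (α := ℝ) (m := n * (D i j).num) (n := (D i j).den)

theorem sum_entryEstimate_le (i : Fin n) :
    ∑ j, entryEstimate D i j ≤ degreeEstimate D ∧ ∑ j, entryEstimate D j i ≤ degreeEstimate D :=
  max_le_iff.1 (Finset.le_sup (f := fun i =>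
    max (∑ j, entryEstimate D i j) (∑ j, entryEstimate D j i)) (Finset.mem_univ i))

theorem sumsAtMost_demandBound (hn : 0 < n) : SumsAtMost D (demandBound D) := by
  have hn₀ : (0 : ℝ) < n := by exact_mod_cast hn
  have hr : (degreeEstimate D : ℝ) ≤ n * demandBound D := by
    exact_mod_cast (Nat.lt_mul_div_succ _ hn).le
  constructor
  · intro i
    refine le_of_mul_le_mul_left ?_ hn₀
    calc (n : ℝ) * ∑ j, (D i j : ℝ) ≤ ((∑ j, entryEstimate D i j : ℕ) : ℝ) := by
          rw [Finset.mul_sum]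
          push_cast
          exact Finset.sum_le_sum fun j _ => mul_le_entryEstimate i j
      _ ≤ degreeEstimate D := by exact_mod_cast (sum_entryEstimate_le i).1
      _ ≤ _ := hr
  · intro i
    refine le_of_mul_le_mul_left ?_ hn₀
    calc (n : ℝ) * ∑ j, (D j i : ℝ) ≤ ((∑ j, entryEstimate D j i : ℕ) : ℝ) := by
          rw [Finset.mul_sum]
          push_cast
          exact Finset.sum_le_sum fun j _ => mul_le_entryEstimate j i
      _ ≤ degreeEstimate D := by exact_mod_cast (sum_entryEstimate_le i).2
      _ ≤ _ := hr

/-- Rounding `n * D i j` instead of `D i j` costs at most `1` per entry, hence `n` per row, hence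
only `1` after division by `n`. The final rounding costs another `1`. -/
theorem demandBound_le (hn : 0 < n) {B : ℝ} (hD : SumsAtMost D B) : (demandBound D : ℝ) ≤ B + 2 := by
  have hn₀ : (0 : ℝ) < n := by exact_mod_cast hn
  have hr : (degreeEstimate D : ℝ) ≤ n * B + n := by
    obtain ⟨i, -, hi⟩ := Finset.exists_mem_eq_sup Finset.univ ⟨⟨0, hn⟩, Finset.mem_univ _⟩
      fun i => max (∑ j, entryEstimate D i j) (∑ j, entryEstimate D j i)
    rw [degreeEstimate, hi, Nat.cast_max]
    push_cast
    refine max_le ?_ ?_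
    · calc ∑ j, (entryEstimate D i j : ℝ) ≤ ∑ j, ((n : ℝ) * D i j + 1) :=
            Finset.sum_le_sum fun j _ => entryEstimate_le i j
        _ = n * ∑ j, (D i j : ℝ) + n := by
            simp [Finset.sum_add_distrib, Finset.mul_sum]
        _ ≤ n * B + n := by
            have := mul_le_mul_of_nonneg_left (hD.1 i) hn₀.le
            linarith
    · calc ∑ j, (entryEstimate D j i : ℝ) ≤ ∑ j, ((n : ℝ) * D j i + 1) :=
            Finset.sum_le_sum fun j _ => entryEstimate_le j i
        _ = n * ∑ j, (D j i : ℝ) + n := by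
            simp [Finset.sum_add_distrib, Finset.mul_sum]
        _ ≤ n * B + n := by
            have := mul_le_mul_of_nonneg_left (hD.2 i) hn₀.le
            linarith
  have hdiv : ((degreeEstimate D / n : ℕ) : ℝ) ≤ B + 1 := by
    refine Nat.cast_div_le.trans ?_
    rw [div_le_iff₀ hn₀]
    linarith
  rw [demandBound]
  push_cast
  linarith

/-- Every entry estimate is at least `1`, even for zero demands. This keeps the base at least `2`
for `n ≥ 2`. -/
theorem two_le_demandBound (hn : 0 < n) : 2 ≤ demandBound D := by
  have h : n ≤ degreeEstimate D := by
    refine le_trans ?_ (sum_entryEstimate_le ⟨0, hn⟩).1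
    calc n = ∑ _j : Fin n, 1 := by simp
      _ ≤ _ := Finset.sum_le_sum fun j _ => Nat.succ_le_succ (Nat.zero_le _)
  have := Nat.div_pos h hn
  unfold demandBound
  omega

theorem routeBase_pos (hn : 0 < n) : 0 < routeBase D :=
  lt_min (Nat.succ_pos _) hn

theorem two_le_routeBase (hn : 2 ≤ n) : 2 ≤ routeBase D :=
  le_min (two_le_demandBound (by omega)) hn

theorem le_routeBase_pow : n ≤ routeBase D ^ routeDigits D := by
  rcases Nat.lt_or_ge n 2 with h | h
  · rw [routeDigits, Nat.clog_of_right_le_one (by omega), pow_zero]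
    omega
  · exact Nat.le_pow_clog (two_le_routeBase h) n

theorem routeModulus_le : routeModulus D ≤ routeBase D ^ routeDigits D := Nat.mul_div_le _ _

theorem le_routeModulus (hn : 0 < n) : n ≤ routeModulus D :=
  Nat.le_mul_of_pos_right _ (Nat.div_pos le_routeBase_pow hn)

/-- Rounding down to a multiple of `n` loses less than `n`, and the multiple itself is at least `n`.
-/
theorem pow_le_two_mul_routeModulus (hn : 0 < n) :
    routeBase D ^ routeDigits D ≤ 2 * routeModulus D := by
  have h₁ := Nat.div_add_mod (routeBase D ^ routeDigits D) n
  have h₂ := Nat.mod_lt (routeBase D ^ routeDigits D) hn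
  have h₃ := le_routeModulus (D := D) hn
  unfold routeModulus at *
  omega

/-- This is the capacity condition of the routing. It combines `b ^ d ≤ 2 * N` with `2 * β ≤ b * m`;
the factor `2` in the slot length makes up for the rounding of the modulus. -/
theorem pow_mul_demandBound_le (hn : 0 < n) :
    routeBase D ^ (routeDigits D - 1) * demandBound D ≤ routeModulus D * routeSlot D := by
  have h₁ : 2 * demandBound D ≤ routeBase D * routeSlot D :=
    (Nat.lt_mul_div_succ _ (routeBase_pos hn)).le
  have h₂ : routeBase D ^ (routeDigits D - 1) * routeBase D = routeBase D ^ routeDigits D := by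
    -- For `n = 1` there are no digits and `routeDigits D - 1` truncates to `0`; the identity
    -- survives because the base is `1`.
    rcases Nat.lt_or_ge n 2 with h | h
    · have : routeBase D = 1 := by
        have := two_le_demandBound (D := D) hn
        unfold routeBase
        omega
      simp [this]
    · have : 0 < routeDigits D := Nat.clog_pos (two_le_routeBase h) h
      rw [← pow_succ, Nat.sub_add_cancel this]
  have h₃ := Nat.mul_le_mul_right (routeSlot D) (pow_le_two_mul_routeModulus (D := D) hn)
  have h₄ := Nat.mul_le_mul_left (routeBase D ^ (routeDigits D - 1)) h₁
  rw [← mul_assoc _ (routeBase D), h₂] at h₄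
  linarith

theorem spreadAlgorithm_isIntegralRouting (n : ℕ) (D : Matrix (Fin n) (Fin n) NNRat) :
    IsIntegralRouting D (spreadAlgorithm n D).makespan (spreadAlgorithm n D).flow := by
  rcases Nat.eq_zero_or_pos n with rfl | hn
  · exact ⟨⟨fun t p => (p 0).elim0, fun _ a => a.elim0, fun i => i.elim0⟩,
      fun _ a => a.elim0, fun _ a => a.elim0⟩
  · exact spreadSchedule_isIntegralRouting (routeBase_pos hn) routeModulus_le (Dvd.intro _ rfl)
      (fun hn => hn.trans_le (le_routeModulus hn)) (Nat.succ_pos _) (sumsAtMost_demandBound hn)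
      (by exact_mod_cast pow_mul_demandBound_le hn)

theorem spreadAlgorithm_avg_le (n : ℕ) (D : Matrix (Fin n) (Fin n) NNRat) :
    (spreadAlgorithm n D).avg D ≤ (spreadAlgorithm n D).makespan :=
  avgCompletionTime_le (spreadAlgorithm_isIntegralRouting n D).1.nonneg fun i j =>
    spreadSchedule_delivered (routeBase_pos i.pos) routeModulus_le (Dvd.intro _ rfl)
      (i.pos.trans_le (le_routeModulus i.pos)) (Nat.succ_pos _) i j

/-! ### The upper bound on the makespan. -/

theorem half_le_log {x : ℝ} (hx : 2 ≤ x) : 1 / 2 ≤ Real.log x := by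
  linarith [Real.log_le_log two_pos hx, Real.log_two_gt_d9]

/-- The function `x / log x` is monotone up to a constant factor. -/
theorem div_log_le {x y : ℝ} (hx : 2 ≤ x) (hxy : x ≤ y) :
    x / Real.log x ≤ 2 * (y / Real.log y) := by
  have hlx := half_le_log hx
  have hly := half_le_log (hx.trans hxy)
  have h₁ : Real.log y = Real.log x + Real.log (y / x) := by
    rw [Real.log_div (by linarith) (by linarith)]
    ring
  have h₂ := Real.log_le_sub_one_of_pos (show 0 < y / x by apply div_pos <;> linarith)
  have h₃ : 1 ≤ y / x := by rwa [le_div_iff₀ (by linarith), one_mul]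
  -- `log y ≤ log x + y / x - 1`, and `log x ≥ 1 / 2` together with `y / x ≥ 1` absorbs the linear
  -- term.
  have h₄ : Real.log y ≤ 2 * (y / x) * Real.log x := by nlinarith
  have h₅ : x * Real.log y ≤ 2 * y * Real.log x := by
    have := mul_le_mul_of_nonneg_left h₄ (show 0 ≤ x by linarith)
    have e : x * (2 * (y / x) * Real.log x) = 2 * y * Real.log x := by
      field_simp
    linarith
  rw [← mul_div_assoc, div_le_div_iff₀ (by linarith) (by linarith)]
  exact h₅

theorem spreadAlgorithm_makespan_le (hn : 2 ≤ n) :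
    ((spreadAlgorithm n D).makespan : ℝ) ≤
      24 * demandBound D * (Real.log n / Real.log (routeBase D)) := by
  have hb := two_le_routeBase (D := D) hn
  have hbn : routeBase D ≤ n := min_le_right _ _
  have hbβ : routeBase D ≤ demandBound D := min_le_left _ _
  have hd : 0 < routeDigits D := Nat.clog_pos hb hn
  have hbm : routeBase D * routeSlot D ≤ 2 * demandBound D + routeBase D := by
    rw [routeSlot, mul_add, mul_one]
    exact Nat.add_le_add_right (Nat.mul_div_le _ _) _
  have hm : routeSlot D ≤ routeBase D * routeSlot D := Nat.le_mul_of_pos_left _ (by omega)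
  -- Since `b * m ≤ 3 * β`, the slots take at most `6 * d * β`; the summands `1` and `m` are
  -- absorbed because `d ≥ 1` and `β ≥ 2`.
  have hT : (spreadAlgorithm n D).makespan ≤ 12 * demandBound D * routeDigits D := by
    change 2 * routeDigits D * routeBase D * routeSlot D + 1 + routeSlot D ≤ _
    have h₁ := Nat.mul_le_mul_left (2 * routeDigits D)
      (hbm.trans (show _ ≤ 3 * demandBound D by omega))
    have h₂ := Nat.mul_le_mul_left (3 * demandBound D) hd
    rw [← mul_assoc] at h₁
    have h₃ : 2 ≤ demandBound D := hb.trans hbβ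
    linarith
  have hb₀ : (2 : ℝ) ≤ routeBase D := by exact_mod_cast hb
  have hlb := half_le_log hb₀
  have hlog : Real.log (routeBase D) ≤ Real.log n :=
    Real.log_le_log (by linarith) (by exact_mod_cast hbn)
  -- `b ^ (d - 1) ≤ n` bounds `d - 1` by `log n / log b`, and `b ≤ n` bounds the missing `1` by the
  -- same quotient.
  have hdigits : (routeDigits D : ℝ) ≤ 2 * (Real.log n / Real.log (routeBase D)) := by
    have h₁ := (Nat.pow_pred_clog_lt_self hb (x := n) hn).le
    have h₂ : (routeBase D : ℝ) ^ (routeDigits D - 1) ≤ n := by exact_mod_cast h₁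
    have h₃ := Real.log_le_log (by positivity) h₂
    rw [Real.log_pow, Nat.cast_sub hd, Nat.cast_one] at h₃
    rw [← mul_div_assoc, le_div_iff₀ (by linarith)]
    linarith
  calc ((spreadAlgorithm n D).makespan : ℝ) ≤ 12 * demandBound D * routeDigits D := by
        exact_mod_cast hT
    _ ≤ 12 * demandBound D * (2 * (Real.log n / Real.log (routeBase D))) :=
        mul_le_mul_of_nonneg_left hdigits (by positivity)
    _ = _ := by ring

theorem spreadAlgorithm_guarantee (hn : 2 ≤ n) {B : ℝ} (hD : SumsAtMost D B) :
    (B ≤ 2 → ((spreadAlgorithm n D).makespan : ℝ) ≤ 192 * Real.log n) ∧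
    (2 ≤ B → B ≤ n →
      ((spreadAlgorithm n D).makespan : ℝ) ≤ 192 * (B * Real.log n / Real.log B)) ∧
    ((n : ℝ) ≤ B → ((spreadAlgorithm n D).makespan : ℝ) ≤ 192 * B) := by
  have hβ := demandBound_le (by omega) hD
  have hT := spreadAlgorithm_makespan_le (D := D) hn
  have hn₀ : (2 : ℝ) ≤ n := by exact_mod_cast hn
  have hln := half_le_log hn₀
  have hβ2 : (2 : ℝ) ≤ demandBound D := by exact_mod_cast two_le_demandBound (by omega)
  have hb2 : (2 : ℝ) ≤ routeBase D := by exact_mod_cast two_le_routeBase hn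
  have hlb := half_le_log hb2
  have hsmall : demandBound D ≤ n → ((spreadAlgorithm n D).makespan : ℝ) ≤
      24 * Real.log n * (demandBound D / Real.log (demandBound D)) := by
    intro h
    rw [routeBase, min_eq_left h] at hT
    refine hT.trans (le_of_eq ?_)
    ring
  have hlarge : n ≤ demandBound D →
      ((spreadAlgorithm n D).makespan : ℝ) ≤ 24 * demandBound D := by
    intro h
    rw [routeBase, min_eq_right h, div_self (by linarith), mul_one] at hT
    exact hT
  refine ⟨fun h => ?_, fun h2 h => ?_, fun h => ?_⟩
  -- `β ≤ B + 2 ≤ 4` and `log b ≥ 1 / 2` give the constant `24 * 4 * 2 = 192`.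
  · refine hT.trans ?_
    have h₁ : Real.log n / Real.log (routeBase D) ≤ 2 * Real.log n := by
      rw [div_le_iff₀ (by linarith)]
      nlinarith
    calc 24 * (demandBound D : ℝ) * (Real.log n / Real.log (routeBase D))
        ≤ 24 * 4 * (2 * Real.log n) := by
          refine mul_le_mul (by linarith) h₁ (by positivity) (by norm_num)
      _ = 192 * Real.log n := by ring
  · have hlB := half_le_log h2
    -- The estimate `β ≤ B + 2 ≤ 2 * B` may exceed `n` although `B` does not. In that case `B ≤ n`
    -- makes `B` itself at most the target rate.
    rcases le_total (demandBound D) n with hc | hc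
    · refine (hsmall hc).trans ?_
      have h₁ := div_log_le hβ2 (show (demandBound D : ℝ) ≤ 2 * B by linarith)
      have h₂ : 2 * B / Real.log (2 * B) ≤ 2 * B / Real.log B :=
        div_le_div_of_nonneg_left (by linarith) (by linarith)
          (Real.log_le_log (by linarith) (by linarith))
      calc 24 * Real.log n * (demandBound D / Real.log (demandBound D))
          ≤ 24 * Real.log n * (2 * (2 * B / Real.log B)) :=
            mul_le_mul_of_nonneg_left (by linarith) (by linarith)
        _ = 96 * (B * Real.log n / Real.log B) := by ring
        _ ≤ 192 * (B * Real.log n / Real.log B) := by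
            have : 0 ≤ B * Real.log n / Real.log B := by positivity
            linarith
    · refine (hlarge hc).trans ?_
      have h₁ : B ≤ B * Real.log n / Real.log B := by
        rw [le_div_iff₀ (by linarith)]
        exact mul_le_mul_of_nonneg_left (Real.log_le_log (by linarith) h) (by linarith)
      linarith
  · rcases le_total (demandBound D) n with hc | hc
    · refine (hsmall hc).trans ?_
      have h₁ := div_log_le hβ2 (show (demandBound D : ℝ) ≤ n by exact_mod_cast hc)
      have h₂ := mul_le_mul_of_nonneg_left h₁ (show 0 ≤ 24 * Real.log n by linarith)
      have h₃ : 24 * Real.log n * (2 * (n / Real.log n)) = 48 * n := by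
        field_simp
        norm_num
      linarith
    · linarith [hlarge hc]

end Algorithm

/-! ## Lists in blocks -/

theorem List.length_flatMap_const {α β : Type*} {l : List α} {f : α → List β} {k : ℕ}
    (hf : ∀ a, (f a).length = k) : (l.flatMap f).length = l.length * k := by
  induction l with
  | nil => simp
  | cons a l ih => simp [ih, hf, add_mul, add_comm]

theorem List.getD_flatMap_const {α β : Type*} {l : List α} {f : α → List β} {k : ℕ}
    (hf : ∀ a, (f a).length = k) (e : β) {q r : ℕ} (hq : q < l.length) (hr : r < k) :
    (l.flatMap f).getD (q * k + r) e = (f l[q]).getD r e := by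
  induction l generalizing q with
  | nil => simp at hq
  | cons a l ih =>
    cases q with
    | zero =>
      simp only [List.flatMap_cons, zero_mul, zero_add, List.getElem_cons_zero]
      exact List.getD_append _ _ _ _ (by rw [hf]; exact hr)
    | succ q =>
      rw [List.flatMap_cons, List.getD_append_right _ _ _ _ (by rw [hf, add_mul]; omega), hf,
        show (q + 1) * k + r - k = q * k + r by rw [add_mul]; omega,
        ih (by simpa using hq)]
      rfl

theorem List.flatMap_range_succ {β : Type*} (f : ℕ → List β) (k : ℕ) :
    (List.range (k + 1)).flatMap f = (List.range k).flatMap f ++ f k := by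
  simp [List.range_succ]

theorem encodeDemand_getD {n : ℕ} (D : Matrix (Fin n) (Fin n) NNRat) (i j : Fin n) :
    (encodeDemand D).getD (1 + 2 * (i * n + j)) 0 = (D i j).num ∧
      (encodeDemand D).getD (2 + 2 * (i * n + j)) 0 = (D i j).den := by
  have key : ∀ r < 2, (encodeDemand D).getD (2 * (i * n + j) + r + 1) 0 =
      [(D i j).num, (D i j).den].getD r 0 := by
    intro r hr
    rw [encodeDemand, List.getD_cons_succ,
      show 2 * (i.val * n + j) + r = i * (n * 2) + (j * 2 + r) by ring]
    have hj := j.2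
    rw [List.getD_flatMap_const (k := n * 2)
      (fun a => by rw [List.length_flatMap_const (k := 2) fun _ => rfl, List.length_finRange]) 0
      (by simp) (by omega), List.getD_flatMap_const (k := 2) (fun _ => rfl) 0 (by simp) hr]
    simp
  constructor
  · have := key 0 (by omega)
    rw [show 2 * (i.val * n + j) + 0 + 1 = 1 + 2 * (i * n + j) by ring] at this
    exact this
  · have := key 1 (by omega)
    rw [show 2 * (i.val * n + j) + 1 + 1 = 2 + 2 * (i * n + j) by ring] at this
    exact this

/-! ## The program -/

namespace Program

open PTerm

/-- The variables outside `l` have the same values. -/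
def AgreeOff (l : List ℕ) (σ σ' : ℕ → ℕ) : Prop := ∀ v ∉ l, σ' v = σ v

theorem AgreeOff.refl (l : List ℕ) (σ : ℕ → ℕ) : AgreeOff l σ σ := fun _ _ => rfl

theorem AgreeOff.trans {l : List ℕ} {σ σ' σ'' : ℕ → ℕ} (h : AgreeOff l σ σ')
    (h' : AgreeOff l σ' σ'') : AgreeOff l σ σ'' := fun v hv => (h' v hv).trans (h v hv)

theorem AgreeOff.mono {l l' : List ℕ} {σ σ' : ℕ → ℕ} (h : AgreeOff l σ σ') (hl : l ⊆ l') :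
    AgreeOff l' σ σ' := fun v hv => h v fun hv' => hv (hl hv')

theorem AgreeOff.update {l : List ℕ} {σ σ' : ℕ → ℕ} (h : AgreeOff l σ σ') {v : ℕ} (hv : v ∈ l)
    (x : ℕ) : AgreeOff l σ (Function.update σ' v x) := fun u hu => by
  rw [Function.update_of_ne (by rintro rfl; exact hu hv), h u hu]

/-- Write the hops for the digits of `z`, starting at node `start` and slot group `base`. -/
def hopLoop (base z start : PTerm) : Program :=
  -- Throughout the program: `0` is `n`; `1`, `2` are `i`, `j`; `3` to `5` hold the degree
  -- estimates; `6` is the demand bound, `7` the base, `8` the number of digits, `9` a power of the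
  -- base, `10` the modulus, `11` the slot length; `12`, `13` are the two distances; `14`, `15` are
  -- the digit index and its power of the base; `16` is the arrival time.
  block [assign 14 (const 0), assign 15 (const 1), repeatWhile (var 8 - var 14) (block [
    emit (((base + var 14) * var 7 + z / var 15 % var 7) * var 11),
    emit ((start + z % (var 15 * var 7)) % var 0),
    assign 15 (var 15 * var 7),
    assign 14 (var 14 + const 1)])]

variable {N M : ℕ} {inp : List ℕ} {σ : ℕ → ℕ} {out : List ℕ} {Q : (ℕ → ℕ) → List ℕ → Prop}

/-- The three terms are re-evaluated in every round, so their values must not depend on the loop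
variables `14` and `15`; the hypotheses with `AgreeOff` express this. Digits are extracted with the
running power of the base in variable `15`. -/
theorem transforms_hopLoop {base z start : PTerm} {n b d m bv zv st : ℕ} (hdN : d ≤ N)
    (hσ0 : σ 0 = n) (hσ7 : σ 7 = b) (hσ8 : σ 8 = d) (hσ11 : σ 11 = m)
    (hbase : ∀ σ', AgreeOff [14, 15] σ σ' → base.val inp σ' = bv)
    (hz : ∀ σ', AgreeOff [14, 15] σ σ' → z.val inp σ' = zv)
    (hstart : ∀ σ', AgreeOff [14, 15] σ σ' → start.val inp σ' = st)
    (hn : 0 < n) (hnM : n ≤ M) (hb : 0 < b) (hpow : b ^ d ≤ M) (hdM : d ≤ M)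
    (htime : ∀ s < d, ((bv + s) * b + zv / b ^ s % b) * m ≤ M) (hlen : out.length + 2 * d ≤ M)
    (hQ : ∀ σ', AgreeOff [14, 15] σ σ' → Q σ' (out ++ (List.range d).flatMap fun s =>
      [((bv + s) * b + zv / b ^ s % b) * m, (st + zv % b ^ (s + 1)) % n])) :
    (hopLoop base z start).Transforms N M inp σ out Q := by
  refine transforms_cons (transforms_assign (Nat.zero_le _)
    (transforms_cons (transforms_assign (hn.trans_le hnM) (transforms_cons
    (transforms_repeatWhile (fun k σ' out' => AgreeOff [14, 15] σ σ' ∧ σ' 14 = k ∧ σ' 15 = b ^ k ∧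
      out' = out ++ (List.range k).flatMap fun s =>
        [((bv + s) * b + zv / b ^ s % b) * m, (st + zv % b ^ (s + 1)) % n]) hdN
      ?_ ?_ ?_ ?_ ?_)))))
  · exact ⟨((AgreeOff.refl _ _).update (by simp) _).update (by simp) _,
      by simp, by simp, by simp⟩
  · rintro k hk σ' out' ⟨hag, h14, -, -⟩
    have h8 : σ' 8 = d := (hag 8 (by simp)).trans hσ8
    simp only [val_sub, val_var, h14, h8]
    omega
  · rintro k hk σ' out' ⟨hag, h14, h15, rfl⟩
    have h0 : σ' 0 = n := (hag 0 (by simp)).trans hσ0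
    have h7 : σ' 7 = b := (hag 7 (by simp)).trans hσ7
    have h11 : σ' 11 = m := (hag 11 (by simp)).trans hσ11
    have hl : ∀ k, ((List.range k).flatMap fun s =>
        [((bv + s) * b + zv / b ^ s % b) * m, (st + zv % b ^ (s + 1)) % n]).length = k * 2 :=
      fun k => by rw [List.length_flatMap_const (k := 2) fun _ => rfl, List.length_range]
    have hpk : b ^ (k + 1) ≤ M := (Nat.pow_le_pow_right hb hk).trans hpow
    have e1 : (((base + var 14) * var 7 + z / var 15 % var 7) * var 11 : PTerm).val inp σ' =
        ((bv + k) * b + zv / b ^ k % b) * m := by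
      simp [hbase σ' hag, hz σ' hag, h7, h11, h14, h15]
    have e2 : ((start + z % (var 15 * var 7)) % var 0 : PTerm).val inp σ' =
        (st + zv % b ^ (k + 1)) % n := by
      simp [hstart σ' hag, hz σ' hag, h7, h0, h15, pow_succ]
    refine transforms_cons (transforms_emit (by rw [e1]; exact htime k hk)
      (by rw [List.length_append, hl]; omega) (transforms_cons (transforms_emit
        (by rw [e2]; exact (Nat.mod_lt _ hn).le.trans hnM)
        (by simp only [List.length_append, hl, List.length_cons, List.length_nil]; omega)
        (transforms_cons (transforms_assign ?_ (transforms_cons (transforms_assign ?_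
          (transforms_nil ⟨?_, ?_, ?_, ?_⟩))))))))
    · simpa [h15, h7, ← pow_succ] using hpk
    · simp only [val_add, val_var, val_const, Function.update_apply, h14]
      simp
      omega
    · exact (hag.update (by simp) _).update (by simp) _
    · simp [h14]
    · simp [h15, h7, pow_succ]
    · rw [e1, e2, List.flatMap_range_succ]
      simp
  · rintro σ' out' ⟨hag, h14, -, -⟩
    have h8 : σ' 8 = d := (hag 8 (by simp)).trans hσ8
    simp only [val_sub, val_var, h14, h8]
    omega
  · rintro σ' out' ⟨hag, -, -, rfl⟩
    exact transforms_nil (hQ σ' hag)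

end Program

/-! ### Loops that write the bundles. -/

namespace Program

open PTerm

variable {N M : ℕ} {inp : List ℕ} {σ : ℕ → ℕ} {out : List ℕ} {Q : (ℕ → ℕ) → List ℕ → Prop}

/-- A loop that counts `v` up from `0` to `K - 1` and appends `g k` to the output in round `k`. -/
theorem transforms_countLoop {v K E : ℕ} {l : List ℕ} {t : PTerm} {body : Program}
    {rest : List Program} (g : ℕ → List ℕ) (hg : ∀ k < K, (g k).length = E) (hv : v ∈ l)
    (hKN : K ≤ N) (hlen : out.length + K * E ≤ M)
    (ht : ∀ σ', AgreeOff l σ σ' → t.val inp σ' = K)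
    (hbody : ∀ k < K, ∀ σ' out', AgreeOff l σ σ' → σ' v = k → out'.length + E ≤ M →
      body.Transforms N M inp σ' out' fun σ'' out'' =>
        AgreeOff l σ' σ'' ∧ σ'' v = k + 1 ∧ out'' = out' ++ g k)
    (hQ : ∀ σ', AgreeOff l σ σ' →
      (block rest).Transforms N M inp σ' (out ++ (List.range K).flatMap g) Q) :
    (block (assign v (const 0) :: repeatWhile (t - var v) body :: rest)).Transforms
      N M inp σ out Q := by
  refine transforms_cons (transforms_assign (Nat.zero_le _) (transforms_cons
    (transforms_repeatWhile (fun k σ' out' => AgreeOff l σ σ' ∧ σ' v = k ∧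
      out'.length = out.length + k * E ∧ out' = out ++ (List.range k).flatMap g) hKN
      ?_ ?_ ?_ ?_ ?_)))
  · exact ⟨(AgreeOff.refl _ _).update hv _, by simp, by simp, by simp⟩
  · rintro k hk σ' out' ⟨hag, hvk, -, -⟩
    simp only [val_sub, val_var, hvk, ht σ' hag]
    omega
  · rintro k hk σ' out' ⟨hag, hvk, hl, rfl⟩
    have hkE : (k + 1) * E ≤ K * E := Nat.mul_le_mul_right _ hk
    rw [add_mul] at hkE
    refine (hbody k hk σ' _ hag hvk (by omega)).mono ?_
    rintro σ'' out'' ⟨hag', hvk', rfl⟩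
    refine ⟨hag.trans hag', hvk', ?_, ?_⟩
    · rw [List.length_append, hl, hg k hk, add_mul]
      omega
    · rw [List.flatMap_range_succ, List.append_assoc]
  · rintro σ' out' ⟨hag, hvk, -, -⟩
    simp only [val_sub, val_var, hvk, ht σ' hag]
    omega
  · rintro σ' out' ⟨hag, -, -, rfl⟩
    exact hQ σ' hag

variable {n b d m K : ℕ} {D : Matrix (Fin n) (Fin n) NNRat}

/-- The form matches what `hopLoop` writes, with slot groups starting at `0` and at `d`. -/
theorem spreadBundle_encode (i j : Fin n) (x : ℕ) : (spreadBundle b d m K D i j x).encode =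
    [i.val, 2 * d] ++ ((List.range d).flatMap fun s =>
      [((0 + s) * b + x / b ^ s % b) * m, (i + x % b ^ (s + 1)) % n]) ++
    ((List.range d).flatMap fun s =>
      [((d + s) * b + remainingDistance n K i j x / b ^ s % b) * m,
        (i + x + remainingDistance n K i j x % b ^ (s + 1)) % n]) ++
    [2 * d * b * m + 1, m, (D i j).num, (D i j).den * K * m] := by
  simp [Bundle.encode, spreadBundle, spreadHops, List.flatMap_map, two_mul]

theorem length_spreadBundle_encode (i j : Fin n) (x : ℕ) :
    (spreadBundle b d m K D i j x).encode.length = 4 * d + 6 := by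
  have h : ∀ f : ℕ → List ℕ, (∀ s, (f s).length = 2) →
      ((List.range d).flatMap f).length = d * 2 := fun f hf => by
    rw [List.length_flatMap_const hf, List.length_range]
  rw [spreadBundle_encode]
  simp only [List.length_append, List.length_cons, List.length_nil]
  rw [h _ fun _ => rfl, h _ fun _ => rfl]
  omega

/-- The variables that hold the parameters of the routing. -/
structure RouteVars (n b d m K : ℕ) (σ : ℕ → ℕ) : Prop where
  nodes : σ 0 = n
  base : σ 7 = b
  digits : σ 8 = d
  modulus : σ 10 = K
  slot : σ 11 = m
  arrival : σ 16 = 2 * d * b * m + 1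

theorem RouteVars.of_agreeOff {σ' : ℕ → ℕ} (h : RouteVars n b d m K σ)
    (h' : AgreeOff [1, 2, 12, 13, 14, 15] σ σ') : RouteVars n b d m K σ' where
  nodes := (h' 0 (by simp)).trans h.nodes
  base := (h' 7 (by simp)).trans h.base
  digits := (h' 8 (by simp)).trans h.digits
  modulus := (h' 10 (by simp)).trans h.modulus
  slot := (h' 11 (by simp)).trans h.slot
  arrival := (h' 16 (by simp)).trans h.arrival

/-- The parameters of the routing are small compared to the limits `N` on loops and `M` on values. -/
structure RouteBounds (N M n b d m K : ℕ) (D : Matrix (Fin n) (Fin n) NNRat) : Prop where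
  nodes_le : n ≤ N
  digits_le : d ≤ N
  modulus_le : K ≤ N
  le_values : N ≤ M
  base_pos : 0 < n → 0 < b
  pow_le : b ^ d ≤ M
  time_le : 2 * d * b * m + 1 + m ≤ M
  digits_le_values : 2 * d ≤ M
  num_le : ∀ i j, (D i j).num ≤ M
  den_le : ∀ i j, (D i j).den * K * m ≤ M
  length_le : 2 + n * (n * (K * (4 * d + 6))) ≤ M

/-- Write one bundle. -/
def writeBundle : Program :=
  block [assign 13 ((var 2 + var 0 - var 1 + (var 10 - var 12)) % var 10),
    emit (var 1), emit (const 2 * var 8),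
    hopLoop (const 0) (var 12) (var 1), hopLoop (var 8) (var 13) (var 1 + var 12),
    emit (var 16), emit (var 11),
    emit (input (const 1 + const 2 * (var 1 * var 0 + var 2))),
    emit (input (const 2 + const 2 * (var 1 * var 0 + var 2)) * var 10 * var 11),
    assign 12 (var 12 + const 1)]

theorem transforms_writeBundle (hB : RouteBounds N M n b d m K D)
    (hσ : RouteVars n b d m K σ) {i j : Fin n} {x : ℕ} (hi : σ 1 = i) (hj : σ 2 = j)
    (hx : σ 12 = x) (hxK : x < K) (hlen : out.length + (4 * d + 6) ≤ M) :
    writeBundle.Transforms N M (encodeDemand D) σ out fun σ' out' =>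
      AgreeOff [12, 13, 14, 15] σ σ' ∧ σ' 12 = x + 1 ∧
        out' = out ++ (spreadBundle b d m K D i j x).encode := by
  have hn : 0 < n := i.pos
  have hb := hB.base_pos hn
  have htime : ∀ q < 2 * d, ∀ w, (q * b + w % b) * m ≤ M := by
    intro q hq w
    have h₁ := Nat.mod_lt w hb
    have h₂ : (q + 1) * b ≤ 2 * d * b := Nat.mul_le_mul_right _ hq
    have h₃ : (q * b + w % b) * m ≤ 2 * d * b * m := Nat.mul_le_mul_right _ (by linarith)
    have := hB.time_le
    omega
  have hnM := hB.nodes_le.trans hB.le_values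
  have hdM := hB.digits_le.trans hB.le_values
  have hKM := hB.modulus_le.trans hB.le_values
  have hin := hi.le.trans i.2.le
  have hlenF : ∀ f g : ℕ → ℕ, ((List.range d).flatMap fun s => [f s, g s]).length = d * 2 :=
    fun f g => by rw [List.length_flatMap_const (k := 2) fun _ => rfl, List.length_range]
  have ey : ((var 2 + var 0 - var 1 + (var 10 - var 12)) % var 10 : PTerm).val (encodeDemand D) σ =
      remainingDistance n K i j x := by
    simp [hσ.nodes, hσ.modulus, hi, hj, hx, remainingDistance]
  refine transforms_cons (transforms_assign ?_ ?_)
  · rw [ey]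
    exact (Nat.mod_lt _ (by omega)).le.trans hKM
  rw [ey]
  have hag : AgreeOff [12, 13, 14, 15] σ
      (Function.update σ 13 (remainingDistance n K i j x)) := (AgreeOff.refl _ _).update (by simp) _
  have h13 : Function.update σ 13 (remainingDistance n K i j x) 13 = remainingDistance n K i j x :=
    Function.update_self ..
  have h12 : Function.update σ 13 (remainingDistance n K i j x) 12 = x := by simp [hx]
  generalize Function.update σ 13 (remainingDistance n K i j x) = σ₁ at hag h13 h12 ⊢
  have hv₁ := hσ.of_agreeOff (hag.mono (by simp))
  have h1 : σ₁ 1 = i := (hag 1 (by simp)).trans hi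
  refine transforms_cons (transforms_emit ?_ ?_ (transforms_cons (transforms_emit ?_ ?_
    (transforms_cons (transforms_hopLoop (bv := 0) (zv := x) (st := i) hB.digits_le hv₁.nodes
      hv₁.base hv₁.digits hv₁.slot (fun _ _ => rfl) (fun σ' h => (h 12 (by simp)).trans h12)
      (fun σ' h => (h 1 (by simp)).trans h1) hn hnM hb hB.pow_le hdM ?_ ?_ ?_)))))
  · rw [val_var, h1]
    omega
  · omega
  · rw [val_mul, val_var, val_const, hv₁.digits]
    exact hB.digits_le_values
  · simp
    omega
  · exact fun s hs => htime _ (by omega) _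
  · simp
    omega
  intro σ₂ hag₂
  have hag₂' := hag.trans (hag₂.mono (l' := [12, 13, 14, 15]) (by simp))
  have hv₂ := hσ.of_agreeOff (hag₂'.mono (by simp))
  have h1₂ : σ₂ 1 = i := (hag₂' 1 (by simp)).trans hi
  have h12₂ : σ₂ 12 = x := (hag₂ 12 (by simp)).trans h12
  have h13₂ : σ₂ 13 = remainingDistance n K i j x := (hag₂ 13 (by simp)).trans h13
  refine transforms_cons (transforms_hopLoop (bv := d) (zv := remainingDistance n K i j x)
      (st := i + x) hB.digits_le hv₂.nodes
      hv₂.base hv₂.digits hv₂.slot (fun σ' h => (h 8 (by simp)).trans hv₂.digits)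
      (fun σ' h => (h 13 (by simp)).trans h13₂)
      (fun σ' h => congrArg₂ (· + ·) ((h 1 (by simp)).trans h1₂) ((h 12 (by simp)).trans h12₂))
      hn hnM hb hB.pow_le hdM ?_ ?_ ?_)
  · exact fun s hs => htime _ (by omega) _
  · rw [List.length_append, hlenF]
    simp
    omega
  intro σ₃ hag₃
  have hag₃' := hag₂'.trans (hag₃.mono (l' := [12, 13, 14, 15]) (by simp))
  have hv₃ := hσ.of_agreeOff (hag₃'.mono (by simp))
  have h1₃ : σ₃ 1 = i := (hag₃' 1 (by simp)).trans hi
  have h2₃ : σ₃ 2 = j := (hag₃' 2 (by simp)).trans hj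
  have h12₃ : σ₃ 12 = x := (hag₃ 12 (by simp)).trans h12₂
  have htM := hB.time_le
  have e1 : (input (const 1 + const 2 * (var 1 * var 0 + var 2)) : PTerm).val (encodeDemand D) σ₃ =
      (D i j).num := by
    simp only [val_input, val_add, val_mul, val_var, val_const, h1₃, h2₃, hv₃.nodes]
    exact (encodeDemand_getD D i j).1
  have e2 : (input (const 2 + const 2 * (var 1 * var 0 + var 2)) * var 10 * var 11 : PTerm).val
      (encodeDemand D) σ₃ = (D i j).den * K * m := by
    simp only [val_input, val_add, val_mul, val_var, val_const, h1₃, h2₃, hv₃.nodes, hv₃.modulus,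
      hv₃.slot]
    rw [(encodeDemand_getD D i j).2]
  have hlast : ((var 12 + const 1 : PTerm)).val (encodeDemand D) σ₃ = x + 1 := by
    simp [h12₃]
  refine transforms_cons (transforms_emit ?_ ?_ (transforms_cons (transforms_emit ?_ ?_
    (transforms_cons (transforms_emit ?_ ?_ (transforms_cons (transforms_emit ?_ ?_
    (transforms_cons (transforms_assign ?_ (transforms_nil ⟨hag₃'.update (by simp) _, ?_, ?_⟩))))))))))
  · rw [val_var, hv₃.arrival]
    omega
  · simp only [List.length_append, hlenF, List.length_cons, List.length_nil]
    omega
  · rw [val_var, hv₃.slot]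
    omega
  · simp only [List.length_append, hlenF, List.length_cons, List.length_nil]
    omega
  · rw [e1]
    exact hB.num_le i j
  · simp only [List.length_append, hlenF, List.length_cons, List.length_nil]
    omega
  · rw [e2]
    exact hB.den_le i j
  · simp only [List.length_append, hlenF, List.length_cons, List.length_nil]
    omega
  · rw [hlast]
    omega
  · rw [hlast]
    simp
  · simp only [e1, e2, val_var, val_mul, val_const, hv₃.arrival, hv₃.slot, h1, hv₁.digits]
    rw [spreadBundle_encode]
    simp

/-- Write all bundles. -/
def writeBundles : Program :=
  block [assign 1 (const 0), repeatWhile (var 0 - var 1) (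
    block [assign 2 (const 0), repeatWhile (var 0 - var 2) (
      block [assign 12 (const 0), repeatWhile (var 10 - var 12) writeBundle,
        assign 2 (var 2 + const 1)]),
      assign 1 (var 1 + const 1)])]

/-- Loop counters are natural numbers while bundles are indexed by `Fin n`; this lemma passes
between the two. -/
theorem flatMap_range_dite {β : Type*} (g : Fin n → List β) :
    ((List.range n).flatMap fun k => if h : k < n then g ⟨k, h⟩ else []) =
      (List.finRange n).flatMap g := by
  rw [← List.map_coe_finRange_eq_range, List.flatMap_map]
  simp

theorem spreadSchedule_flatMap_encode :
    (spreadSchedule b d m K D).bundles.flatMap Bundle.encode =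
      (List.range n).flatMap fun k => if hk : k < n then
        (List.range n).flatMap fun l => if hl : l < n then
          (List.range K).flatMap fun x => (spreadBundle b d m K D ⟨k, hk⟩ ⟨l, hl⟩ x).encode
        else [] else [] := by
  rw [flatMap_range_dite fun i => (List.range n).flatMap fun l => if hl : l < n then
    (List.range K).flatMap fun x => (spreadBundle b d m K D i ⟨l, hl⟩ x).encode else []]
  have h : ∀ i : Fin n, ((List.range n).flatMap fun l => if hl : l < n then
      (List.range K).flatMap fun x => (spreadBundle b d m K D i ⟨l, hl⟩ x).encode else []) =
      (List.finRange n).flatMap fun j => (List.range K).flatMap fun x =>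
        (spreadBundle b d m K D i j x).encode := fun i =>
    flatMap_range_dite fun j => (List.range K).flatMap fun x =>
      (spreadBundle b d m K D i j x).encode
  simp only [h]
  simp [spreadSchedule, List.flatMap_assoc, List.flatMap_map]

theorem transforms_writeBundles (hB : RouteBounds N M n b d m K D)
    (hσ : RouteVars n b d m K σ) (hlen : out.length = 2) :
    writeBundles.Transforms N M (encodeDemand D) σ out fun _ out' =>
      out' = out ++ (spreadSchedule b d m K D).bundles.flatMap Bundle.encode := by
  have hlM := hB.length_le
  have hnM := hB.nodes_le.trans hB.le_values
  have hx : ∀ i j : Fin n, ((List.range K).flatMap fun x =>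
      (spreadBundle b d m K D i j x).encode).length = K * (4 * d + 6) := fun i j => by
    rw [List.length_flatMap_const fun x => length_spreadBundle_encode i j x, List.length_range]
  have hj : ∀ i : Fin n, ((List.range n).flatMap fun l => if hl : l < n then
      (List.range K).flatMap fun x => (spreadBundle b d m K D i ⟨l, hl⟩ x).encode
        else []).length = n * (K * (4 * d + 6)) := fun i => by
    rw [flatMap_range_dite fun j => (List.range K).flatMap fun x =>
      (spreadBundle b d m K D i j x).encode, List.length_flatMap_const fun j => hx i j,
      List.length_finRange]
  rw [spreadSchedule_flatMap_encode]
  refine transforms_countLoop (l := [1, 2, 12, 13, 14, 15]) (E := n * (K * (4 * d + 6))) _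
    (fun k hk => by rw [dif_pos hk, hj]) (by simp) hB.nodes_le (by omega)
    (fun σ' h => (hσ.of_agreeOff h).nodes) ?_ fun σ' _ => transforms_nil rfl
  intro k hk σ₁ out₁ hag₁ h1 hl₁
  have hσ₁ := hσ.of_agreeOff hag₁
  rw [dif_pos hk]
  refine transforms_countLoop (l := [2, 12, 13, 14, 15]) (E := K * (4 * d + 6)) (fun l => if hl : l < n then
    (List.range K).flatMap fun x => (spreadBundle b d m K D ⟨k, hk⟩ ⟨l, hl⟩ x).encode else [])
    (fun l hl => by rw [dif_pos hl, hx]) (by simp) hB.nodes_le hl₁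
    (fun σ' h => (hσ₁.of_agreeOff (h.mono (by simp))).nodes) ?_ ?_
  · intro l hl σ₂ out₂ hag₂ h2 hl₂
    have hσ₂ := hσ₁.of_agreeOff (hag₂.mono (by simp))
    have h1₂ : σ₂ 1 = k := (hag₂ 1 (by simp)).trans h1
    rw [dif_pos hl]
    refine transforms_countLoop (l := [12, 13, 14, 15]) (E := 4 * d + 6)
      (fun x => (spreadBundle b d m K D ⟨k, hk⟩ ⟨l, hl⟩ x).encode)
      (fun x _ => length_spreadBundle_encode _ _ x) (by simp) hB.modulus_le hl₂
      (fun σ' h => (hσ₂.of_agreeOff (h.mono (by simp))).modulus) ?_ ?_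
    · intro x hxK σ₃ out₃ hag₃ h12 hl₃
      exact transforms_writeBundle hB (hσ₂.of_agreeOff (hag₃.mono (by simp)))
        (i := ⟨k, hk⟩) (j := ⟨l, hl⟩) ((hag₃ 1 (by simp)).trans h1₂) ((hag₃ 2 (by simp)).trans h2)
        h12 hxK hl₃
    · intro σ₃ hag₃
      have h2₃ : σ₃ 2 = l := (hag₃ 2 (by simp)).trans h2
      refine transforms_cons (transforms_assign ?_ (transforms_nil
        ⟨(hag₃.mono (by simp)).update (by simp) _, by simp [h2₃], rfl⟩))
      simp only [val_add, val_var, val_const, h2₃]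
      omega
  · intro σ₂ hag₂
    have h1₂ : σ₂ 1 = k := (hag₂ 1 (by simp)).trans h1
    refine transforms_cons (transforms_assign ?_ (transforms_nil
      ⟨(hag₂.mono (by simp)).update (by simp) _, by simp [h1₂], rfl⟩))
    simp only [val_add, val_var, val_const, h1₂]
    omega

end Program

/-! ### Computing the parameters of the routing. -/

namespace Program

open PTerm

variable {N M n : ℕ} {σ : ℕ → ℕ} {out : List ℕ} {Q : (ℕ → ℕ) → List ℕ → Prop}
  {D : Matrix (Fin n) (Fin n) NNRat}

/-- The estimate for an entry, computed from the input list. -/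
def inputEstimate (n : ℕ) (inp : List ℕ) (i j : ℕ) : ℕ :=
  n * inp.getD (1 + 2 * (i * n + j)) 0 / inp.getD (2 + 2 * (i * n + j)) 0 + 1

theorem inputEstimate_encodeDemand (i j : Fin n) :
    inputEstimate n (encodeDemand D) i j = entryEstimate D i j := by
  rw [inputEstimate, (encodeDemand_getD D i j).1, (encodeDemand_getD D i j).2, entryEstimate]

theorem degreeEstimate_eq_sup_range : degreeEstimate D = (Finset.range n).sup fun i =>
    max (∑ j ∈ Finset.range n, inputEstimate n (encodeDemand D) i j)
      (∑ j ∈ Finset.range n, inputEstimate n (encodeDemand D) j i) := by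
  simp only [Finset.sum_range]
  refine le_antisymm (Finset.sup_le fun i _ => ?_) (Finset.sup_le fun i hi => ?_)
  · refine le_trans (le_of_eq ?_) (Finset.le_sup (Finset.mem_range.2 i.2))
    simp only [inputEstimate_encodeDemand]
  · have hi := Finset.mem_range.1 hi
    refine le_trans (le_of_eq ?_) (Finset.le_sup (Finset.mem_univ (⟨i, hi⟩ : Fin n)))
    simp only [← inputEstimate_encodeDemand]

/-- The term that computes the estimate for the entry in row `u` and column `v`. -/
def estimateTerm (u v : ℕ) : PTerm :=
  var 0 * input (const 1 + const 2 * (var u * var 0 + var v)) /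
    input (const 2 + const 2 * (var u * var 0 + var v)) + const 1

/-- Compute the largest estimated row sum or column sum. -/
def estimateDegrees : Program :=
  block [assign 0 (input (const 0)), assign 3 (const 0), assign 1 (const 0),
    repeatWhile (var 0 - var 1) (block [assign 4 (const 0), assign 5 (const 0), assign 2 (const 0),
      repeatWhile (var 0 - var 2) (block [assign 4 (var 4 + estimateTerm 1 2),
        assign 5 (var 5 + estimateTerm 2 1), assign 2 (var 2 + const 1)]),
      assign 3 (var 3 + (var 4 - var 3)), assign 3 (var 3 + (var 5 - var 3)),
      assign 1 (var 1 + const 1)])]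

theorem transforms_estimateDegrees (hnN : n ≤ N) (hnM : n ≤ M) (hdeg : degreeEstimate D ≤ M)
    (hQ : ∀ σ', σ' 0 = n → σ' 3 = degreeEstimate D → Q σ' out) :
    estimateDegrees.Transforms N M (encodeDemand D) σ out Q := by
  set e := inputEstimate n (encodeDemand D) with he
  rw [degreeEstimate_eq_sup_range] at hdeg hQ
  set F : ℕ → ℕ := fun i => max (∑ j ∈ Finset.range n, e i j) (∑ j ∈ Finset.range n, e j i) with hF
  have hFM : ∀ i < n, F i ≤ M := fun i hi =>
    (Finset.le_sup (f := F) (Finset.mem_range.2 hi)).trans hdeg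
  have hsupM : ∀ k ≤ n, (Finset.range k).sup F ≤ M := fun k hk =>
    (Finset.sup_mono (Finset.range_mono hk)).trans hdeg
  -- Partial sums never exceed the final degree estimate, so the accumulators respect the limit `M`
  -- during the loops.
  have hpart : ∀ i < n, ∀ k ≤ n, ∑ j ∈ Finset.range k, e i j ≤ M ∧
      ∑ j ∈ Finset.range k, e j i ≤ M := fun i hi k hk =>
    ⟨(Finset.sum_le_sum_of_subset (Finset.range_mono hk)).trans
        ((le_max_left _ _).trans (hFM i hi)),
      (Finset.sum_le_sum_of_subset (Finset.range_mono hk)).trans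
        ((le_max_right _ _).trans (hFM i hi))⟩
  have h00 : ((input (const 0) : PTerm)).val (encodeDemand D) σ = n := rfl
  have hterm : ∀ u v (σ' : ℕ → ℕ), σ' 0 = n →
      (estimateTerm u v).val (encodeDemand D) σ' = e (σ' u) (σ' v) := by
    intro u v σ' h0
    simp [estimateTerm, h0, he, inputEstimate]
  refine transforms_cons (transforms_assign (by rwa [h00]) (transforms_cons (transforms_assign
    (Nat.zero_le _) (transforms_cons (transforms_assign (Nat.zero_le _) (transforms_cons
    (transforms_repeatWhile (fun k σ' out' => σ' 0 = n ∧ σ' 1 = k ∧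
      σ' 3 = (Finset.range k).sup F ∧ out' = out) hnN ?_ ?_ ?_ ?_ ?_)))))))
  · simp [h00]
  · rintro k hk σ' out' ⟨h0, h1, -, -⟩
    simp only [val_sub, val_var, h0, h1]
    omega
  · rintro k hk σ₁ out₁ ⟨h0, h1, h3, rfl⟩
    refine transforms_cons (transforms_assign (Nat.zero_le _) (transforms_cons (transforms_assign
      (Nat.zero_le _) (transforms_cons (transforms_assign (Nat.zero_le _) (transforms_cons
      (transforms_repeatWhile (fun l σ' out' => σ' 0 = n ∧ σ' 1 = k ∧ σ' 2 = l ∧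
        σ' 3 = (Finset.range k).sup F ∧ σ' 4 = ∑ j ∈ Finset.range l, e k j ∧
        σ' 5 = ∑ j ∈ Finset.range l, e j k ∧ out' = out₁) hnN ?_ ?_ ?_ ?_ ?_)))))))
    · simp [h0, h1, h3]
    · rintro l hl σ' out' ⟨h0, -, h2, -⟩
      simp only [val_sub, val_var, h0, h2]
      omega
    · rintro l hl σ₂ _ ⟨h0, h1, h2, h3, h4, h5, rfl⟩
      have hp := hpart k hk (l + 1) hl
      rw [Finset.sum_range_succ, Finset.sum_range_succ] at hp
      have e4 : (var 4 + estimateTerm 1 2).val (encodeDemand D) σ₂ =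
          ∑ j ∈ Finset.range l, e k j + e k l := by
        rw [val_add, hterm _ _ _ h0, h1, h2, val_var, h4]
      refine transforms_cons (transforms_assign (by rw [e4]; exact hp.1) ?_)
      rw [e4]
      have e5 : (var 5 + estimateTerm 2 1).val (encodeDemand D)
          (Function.update σ₂ 4 (∑ j ∈ Finset.range l, e k j + e k l)) =
          ∑ j ∈ Finset.range l, e j k + e l k := by
        rw [val_add, hterm _ _ _ (by simp [h0])]
        simp [h1, h2, h5]
      refine transforms_cons (transforms_assign (by rw [e5]; exact hp.2) ?_)
      rw [e5]
      refine transforms_cons (transforms_assign ?_ (transforms_nil ?_))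
      · simp [h2]
        omega
      · simp [h0, h1, h2, h3, Finset.sum_range_succ]
    · rintro σ' out' ⟨h0, -, h2, -⟩
      simp only [val_sub, val_var, h0, h2]
      omega
    · rintro σ₂ _ ⟨h0, h1, h2, h3, h4, h5, rfl⟩
      have hs := hsupM (k + 1) hk
      rw [Finset.range_add_one, Finset.sup_insert] at hs
      have hs' := max_le_iff.1 hs
      have hF' := max_le_iff.1 hs'.1
      -- Truncated subtraction replaces a comparison in the program.
      have hmax : ∀ x y : ℕ, x + (y - x) = max x y := by omega
      refine transforms_cons (transforms_assign ?_ (transforms_cons (transforms_assign ?_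
        (transforms_cons (transforms_assign ?_ (transforms_nil ⟨?_, ?_, ?_, rfl⟩))))))
      · simp only [val_add, val_sub, val_var, h3, h4, hmax]
        exact max_le hs'.2 hF'.1
      · simp only [val_add, val_sub, val_var, h3, h4, hmax]
        simp only [Function.update_self, ne_eq, Nat.reduceEqDiff, not_false_eq_true,
          Function.update_of_ne, h5]
        exact max_le (max_le hs'.2 hF'.1) hF'.2
      · simp [h1]
        omega
      · simp [h0]
      · simp [h1]
      · rw [Finset.range_add_one, Finset.sup_insert]
        simp only [val_add, val_sub, val_var, h3, h4, hmax]
        simp only [Function.update_self, ne_eq, OfNat.ofNat_ne_one,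
          Nat.reduceEqDiff, not_false_eq_true, Function.update_of_ne, h5, hF]
        rw [max_assoc, max_comm]
  · rintro σ' out' ⟨h0, h1, -, -⟩
    simp only [val_sub, val_var, h0, h1]
    omega
  · rintro σ' _ ⟨h0, -, h3, rfl⟩
    exact transforms_nil (hQ σ' h0 h3)

/-- Compute the parameters of the routing, and write the schedule. -/
def writeSchedule : Program :=
  block [assign 6 (var 3 / var 0 + const 1), assign 7 (var 6 - (var 6 - var 0)),
    assign 8 (const 0), assign 9 (const 1),
    repeatWhile (var 0 - var 9) (block [assign 9 (var 9 * var 7), assign 8 (var 8 + const 1)]),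
    assign 10 (var 0 * (var 9 / var 0)), assign 11 (const 2 * var 6 / var 7 + const 1),
    assign 16 (const 2 * var 8 * var 7 * var 11 + const 1),
    emit (var 16 + var 11), emit (var 0 * var 0 * var 10), writeBundles]

theorem spreadSchedule_length_bundles {b d m K : ℕ} :
    (spreadSchedule b d m K D).bundles.length = n * n * K := by
  rw [spreadSchedule]
  dsimp only
  rw [List.length_flatMap_const (k := n * K) fun i => by
    rw [List.length_flatMap_const (k := K) fun j => by simp, List.length_finRange],
    List.length_finRange, mul_assoc]

theorem transforms_writeSchedule
    (hB : RouteBounds N M n (routeBase D) (routeDigits D) (routeSlot D) (routeModulus D) D)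
    (hdeg : degreeEstimate D + 1 ≤ M) (h0 : σ 0 = n) (h3 : σ 3 = degreeEstimate D) :
    writeSchedule.Transforms N M (encodeDemand D) σ [] fun _ out' =>
      out' = (spreadAlgorithm n D).encode := by
  have hnM := hB.nodes_le.trans hB.le_values
  have hdM := hB.digits_le.trans hB.le_values
  have hKM := hB.modulus_le.trans hB.le_values
  have htM := hB.time_le
  have hlM := hB.length_le
  have hβ : (var 3 / var 0 + const 1 : PTerm).val (encodeDemand D) σ = demandBound D := by
    simp [h0, h3, demandBound]
  have hβM : demandBound D ≤ M := by
    have := Nat.div_le_self (degreeEstimate D) n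
    unfold demandBound
    omega
  refine transforms_cons (transforms_assign (by rwa [hβ]) ?_)
  rw [hβ]
  -- With truncated subtraction, `β - (β - n)` is the minimum of `β` and `n`.
  have hb : (var 6 - (var 6 - var 0) : PTerm).val (encodeDemand D)
      (Function.update σ 6 (demandBound D)) = routeBase D := by
    simp [h0, routeBase]
    omega
  refine transforms_cons (transforms_assign (by rw [hb]; exact (min_le_left _ _).trans hβM) ?_)
  rw [hb]
  -- The power is multiplied by the base until it reaches `n`. Minimality of `Nat.clog` shows that
  -- this takes exactly `routeDigits D` rounds.
  refine transforms_cons (transforms_assign (Nat.zero_le _) (transforms_cons (transforms_assign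
    (by rw [val_const]; omega) (transforms_cons (transforms_repeatWhile (K := routeDigits D)
    (fun k σ' out' => σ' 0 = n ∧ σ' 6 = demandBound D ∧ σ' 7 = routeBase D ∧ σ' 8 = k ∧
      σ' 9 = routeBase D ^ k ∧ out' = []) hB.digits_le ?_ ?_ ?_ ?_ ?_)))))
  · simp [h0]
  · rintro k hk σ' out' ⟨h0, -, -, -, h9, -⟩
    have := Nat.pow_lt_of_lt_clog hk
    simp only [val_sub, val_var, h0, h9]
    omega
  · rintro k hk σ' out' ⟨h0, h6, h7, h8, h9, rfl⟩
    have hb : 0 < routeBase D := by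
      rcases Nat.eq_zero_or_pos (routeBase D) with h | h
      · simp [routeDigits, h] at hk
      · exact h
    have hpow := (Nat.pow_le_pow_right hb hk).trans hB.pow_le
    refine transforms_cons (transforms_assign ?_ (transforms_cons (transforms_assign ?_
      (transforms_nil ?_))))
    · simpa [h9, h7, pow_succ] using hpow
    · simp [h8]
      omega
    · simp [h0, h6, h7, h8, h9, pow_succ]
  · rintro σ' out' ⟨h0, -, -, -, h9, -⟩
    have := le_routeBase_pow (D := D)
    simp only [val_sub, val_var, h0, h9]
    omega
  rintro σ₁ _ ⟨h0, h6, h7, h8, h9, rfl⟩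
  have e10 : (var 0 * (var 9 / var 0) : PTerm).val (encodeDemand D) σ₁ = routeModulus D := by
    simp [h0, h9, routeModulus]
  refine transforms_cons (transforms_assign (by rwa [e10]) ?_)
  rw [e10]
  have e11 : (const 2 * var 6 / var 7 + const 1 : PTerm).val (encodeDemand D)
      (Function.update σ₁ 10 (routeModulus D)) = routeSlot D := by
    simp [h6, h7, routeSlot]
  refine transforms_cons (transforms_assign (by rw [e11]; omega) ?_)
  rw [e11]
  have e16 : (const 2 * var 8 * var 7 * var 11 + const 1 : PTerm).val (encodeDemand D)
      (Function.update (Function.update σ₁ 10 (routeModulus D)) 11 (routeSlot D)) =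
      2 * routeDigits D * routeBase D * routeSlot D + 1 := by
    simp [h7, h8]
  refine transforms_cons (transforms_assign (by rw [e16]; omega) ?_)
  rw [e16]
  have hv : RouteVars n (routeBase D) (routeDigits D) (routeSlot D) (routeModulus D)
      (Function.update (Function.update (Function.update σ₁ 10 (routeModulus D)) 11 (routeSlot D)) 16
        (2 * routeDigits D * routeBase D * routeSlot D + 1)) := by
    constructor <;> simp [h0, h7, h8]
  revert hv
  generalize Function.update (Function.update (Function.update σ₁ 10 (routeModulus D)) 11
    (routeSlot D)) 16 (2 * routeDigits D * routeBase D * routeSlot D + 1) = σ₂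
  intro hv
  have hcount : n * n * routeModulus D ≤ M := by
    refine le_trans ?_ (le_trans (Nat.le_add_left _ 2) hlM)
    rw [mul_assoc]
    exact Nat.mul_le_mul_left _ (Nat.mul_le_mul_left _ (Nat.le_mul_of_pos_right _ (by omega)))
  refine transforms_cons (transforms_emit ?_ ?_ (transforms_cons (transforms_emit ?_ ?_
    (transforms_cons ((transforms_writeBundles hB hv (by simp)).mono
      fun σ' out' h => transforms_nil ?_)))))
  · rw [val_add, val_var, val_var, hv.arrival, hv.slot]
    exact htM
  · simp
    omega
  · rw [val_mul, val_mul, val_var, val_var, hv.nodes, hv.modulus]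
    exact hcount
  · simp
    omega
  · rw [h, Schedule.encode, spreadAlgorithm, spreadSchedule_length_bundles]
    simp only [val_add, val_mul, val_var, hv.arrival, hv.slot, hv.nodes, hv.modulus]
    rfl

end Program

/-! ## Polynomial time -/

theorem size_lt_bitLength {l : List ℕ} {x : ℕ} (hx : x ∈ l) : x.size < bitLength l :=
  Nat.lt_of_succ_le (List.le_sum_of_mem (List.mem_map.2 ⟨x, hx, rfl⟩))

theorem length_le_bitLength (l : List ℕ) : l.length ≤ bitLength l := by
  induction l with
  | nil => exact Nat.zero_le _
  | cons x l ih =>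
    simp only [bitLength, List.map_cons, List.sum_cons, List.length_cons] at ih ⊢
    omega

theorem getD_lt_two_pow_bitLength (l : List ℕ) (a : ℕ) : l.getD a 0 < 2 ^ bitLength l := by
  rcases lt_or_ge a l.length with h | h
  · rw [List.getD_eq_getElem _ _ h]
    exact (Nat.lt_size_self _).trans
      (Nat.pow_lt_pow_right one_lt_two (size_lt_bitLength (List.getElem_mem h)))
  · rw [List.getD_eq_default _ _ h]
    exact Nat.two_pow_pos _

theorem length_encodeDemand {n : ℕ} (D : Matrix (Fin n) (Fin n) NNRat) :
    (encodeDemand D).length = n * (n * 2) + 1 := by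
  rw [encodeDemand, List.length_cons, List.length_flatMap_const (k := n * 2) fun i => by
    rw [List.length_flatMap_const (k := 2) fun j => rfl, List.length_finRange],
    List.length_finRange]

/-- Everything that limits a loop is at most the bit length `L`, as the input list already has `2 *
n ^ 2 + 1` entries. All other values are products of boundedly many numbers at most `U = 2 ^ L`; the
exponent `12` leaves room for all of them. -/
theorem routeBounds {n : ℕ} (D : Matrix (Fin n) (Fin n) NNRat) :
    Program.RouteBounds (bitLength (encodeDemand D)) (2 ^ (12 * bitLength (encodeDemand D))) n
      (routeBase D) (routeDigits D) (routeSlot D) (routeModulus D) D ∧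
    degreeEstimate D + 1 ≤ 2 ^ (12 * bitLength (encodeDemand D)) := by
  set L := bitLength (encodeDemand D)
  have hL : n * (n * 2) + 1 ≤ L := length_encodeDemand D ▸ length_le_bitLength _
  have hLU : L < 2 ^ L := Nat.lt_two_pow_self
  have hnum : ∀ i j, (D i j).num ≤ 2 ^ L := fun i j =>
    (encodeDemand_getD D i j).1 ▸ (getD_lt_two_pow_bitLength _ _).le
  have hden : ∀ i j, (D i j).den ≤ 2 ^ L := fun i j =>
    (encodeDemand_getD D i j).2 ▸ (getD_lt_two_pow_bitLength _ _).le
  have hnn : n ≤ n * n := Nat.le_mul_self n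
  -- `b ^ (d - 1) < n` and `b ≤ n` give `b ^ d ≤ n ^ 2`, so there are only polynomially many
  -- bundles.
  have hpow : routeBase D ^ routeDigits D ≤ L := by
    rcases Nat.lt_or_ge n 2 with h | h
    · rw [routeDigits, Nat.clog_of_right_le_one (by omega), pow_zero]
      omega
    · have h₁ := Nat.pow_pred_clog_lt_self (two_le_routeBase (D := D) h) (x := n) h
      have h₂ : 0 < routeDigits D := Nat.clog_pos (two_le_routeBase h) h
      have h₃ : routeBase D ^ routeDigits D ≤ n * n := by
        rw [← Nat.sub_add_cancel h₂, pow_succ]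
        exact Nat.mul_le_mul h₁.le (min_le_right _ _)
      linarith
  have hd : routeDigits D ≤ n := by
    rcases Nat.lt_or_ge n 2 with h | h
    · rw [routeDigits, Nat.clog_of_right_le_one (by omega)]
      omega
    · exact Nat.clog_le_of_le_pow
        ((Nat.lt_two_pow_self).le.trans (Nat.pow_le_pow_left (two_le_routeBase h) n))
  have hK : routeModulus D ≤ L := routeModulus_le.trans hpow
  rw [mul_comm 12 L, pow_mul]
  have hU : 2 ≤ 2 ^ L := by
    calc 2 = 2 ^ 1 := rfl
      _ ≤ 2 ^ L := Nat.pow_le_pow_right two_pos (by omega)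
  have hnU : n ≤ 2 ^ L := by linarith
  generalize 2 ^ L = U at *
  have hU1 : ∀ k, 1 ≤ U ^ k := fun k => Nat.one_le_pow _ _ (by omega)
  have hUs : ∀ k l, l = k + 1 → 2 * U ^ k ≤ U ^ l := by
    rintro k _ rfl
    rw [pow_succ, mul_comm]
    exact Nat.mul_le_mul_left _ hU
  have hUm : ∀ k l, k ≤ l → U ^ k ≤ U ^ l := fun k l h => Nat.pow_le_pow_right (by omega) h
  have hentry : ∀ i j, entryEstimate D i j ≤ U ^ 3 := by
    intro i j
    have h₁ : n * (D i j).num / (D i j).den ≤ U * U :=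
      (Nat.div_le_self _ _).trans (Nat.mul_le_mul hnU (hnum i j))
    have h₂ := hUs 2 3 rfl
    have h₃ := hU1 2
    unfold entryEstimate
    rw [← pow_two] at h₁
    omega
  have hsum : ∀ f : Fin n → ℕ, (∀ i, f i ≤ U ^ 3) → ∑ i, f i ≤ U ^ 4 := by
    intro f hf
    calc ∑ i, f i ≤ ∑ _i : Fin n, U ^ 3 := Finset.sum_le_sum fun i _ => hf i
      _ = n * U ^ 3 := by simp
      _ ≤ U * U ^ 3 := Nat.mul_le_mul_right _ hnU
      _ = U ^ 4 := by ring
  have hdeg : degreeEstimate D ≤ U ^ 4 := Finset.sup_le fun i _ =>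
    max_le (hsum _ fun j => hentry i j) (hsum _ fun j => hentry j i)
  have hβ : demandBound D ≤ U ^ 5 := by
    have h₁ := Nat.div_le_self (degreeEstimate D) n
    have h₂ := hUs 4 5 rfl
    have h₃ := hU1 4
    unfold demandBound
    omega
  have hm : routeSlot D ≤ U ^ 7 := by
    have h₁ := Nat.div_le_self (2 * demandBound D) (routeBase D)
    have h₂ := hUs 5 6 rfl
    have h₃ := hUs 6 7 rfl
    have h₄ := hU1 6
    unfold routeSlot
    omega
  have hbU : routeBase D ≤ U := (min_le_right _ _).trans hnU
  have hdU : routeDigits D ≤ U := hd.trans hnU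
  have htime : 2 * routeDigits D * routeBase D * routeSlot D ≤ U ^ 10 := by
    calc 2 * routeDigits D * routeBase D * routeSlot D ≤ U * U * U * U ^ 7 := by gcongr
      _ = U ^ 10 := by ring
  have hlen : n * (n * (routeModulus D * (4 * routeDigits D + 6))) ≤ U ^ 8 := by
    have h₁ : 4 * routeDigits D + 6 ≤ U ^ 5 := by
      have := hUs 1 2 rfl
      have := hUs 2 3 rfl
      have := hUs 3 4 rfl
      have := hUs 4 5 rfl
      rw [pow_one] at *
      omega
    calc _ ≤ U * (U * (U * U ^ 5)) := by
          gcongr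
          omega
      _ = U ^ 8 := by ring
  have h10 := hUs 10 11 rfl
  have h11 := hUs 11 12 rfl
  have h7 := hUm 7 10 (by norm_num)
  have h8 := hUm 8 10 (by norm_num)
  have h4 := hUm 4 10 (by norm_num)
  have h1 := hUm 1 10 (by norm_num)
  have h0 := hU1 10
  rw [pow_one] at h1
  refine ⟨⟨by linarith, by linarith, hK, by omega, routeBase_pos, by omega, by omega, ?_, ?_, ?_,
    by omega⟩, by omega⟩
  · omega
  · intro i j
    have := hnum i j
    omega
  · intro i j
    calc (D i j).den * routeModulus D * routeSlot D ≤ U * U * U ^ 7 := by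
          gcongr
          · exact hden i j
          · omega
      _ = U ^ 9 := by ring
      _ ≤ U ^ 12 := hUm _ _ (by norm_num)

theorem isPolyTime_spreadAlgorithm : IsPolyTime spreadAlgorithm := by
  -- The limit `2 ^ (12 * L)` on values has `12 * L + 1` bits, which is the cell size in the time
  -- bound.
  obtain ⟨q, hq⟩ := Program.exists_polynomial_timeBound (12 * Polynomial.X + 1)
    (Program.estimateDegrees.seq Program.writeSchedule)
  refine ⟨Program.estimateDegrees.seq Program.writeSchedule, q, fun n D => ?_⟩
  obtain ⟨hB, hdeg⟩ := routeBounds D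
  have hnM := hB.nodes_le.trans hB.le_values
  have hT : (Program.estimateDegrees.seq Program.writeSchedule).Transforms
      (bitLength (encodeDemand D)) (2 ^ (12 * bitLength (encodeDemand D))) (encodeDemand D)
      (fun _ => 0) [] fun _ out' => out' = (spreadAlgorithm n D).encode :=
    Program.transforms_seq (Program.transforms_estimateDegrees hB.nodes_le hnM (by omega)
      fun σ' h0 h3 => Program.transforms_writeSchedule hB hdeg h0 h3)
  obtain ⟨k, m, hr, hk, ho⟩ := hT.exists_runs fun a => (getD_lt_two_pow_bitLength _ a).le.trans
    (Nat.pow_le_pow_right two_pos (by omega))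
  refine ⟨k, m, hr, hk.trans (le_of_eq ?_), ho⟩
  rw [hq, Nat.size_pow]
  simp

theorem theorem2 :
    ∃ ALG : (n : ℕ) → Matrix (Fin n) (Fin n) NNRat → Schedule n,
      -- ALG is a polynomial-time algorithm whose output is always an indirect integral routing
      IsPolyTime ALG ∧
      (∀ (n : ℕ) (D : Matrix (Fin n) (Fin n) NNRat),
        IsIntegralRouting D (ALG n D).makespan (ALG n D).flow) ∧
      -- the guarantee for makespan and average completion time
      (∃ C : ℝ, 0 < C ∧ ∀ (n : ℕ), 2 ≤ n → ∀ (D : Matrix (Fin n) (Fin n) NNRat) (B : ℝ),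
        SumsAtMost D B →
          (B ≤ 2 →
            ((ALG n D).makespan : ℝ) ≤ C * Real.log n ∧
            (ALG n D).avg D ≤ C * Real.log n) ∧
          (2 ≤ B → B ≤ n →
            ((ALG n D).makespan : ℝ) ≤ C * (B * Real.log n / Real.log B) ∧
            (ALG n D).avg D ≤ C * (B * Real.log n / Real.log B)) ∧
          ((n : ℝ) ≤ B →
            ((ALG n D).makespan : ℝ) ≤ C * B ∧
            (ALG n D).avg D ≤ C * B)) ∧
      -- the lower bound for every indirect integral routing of uniform demands
      (∃ c : ℝ, 0 < c ∧ ∀ (n : ℕ), 2 ≤ n → ∀ (B : NNRat), 0 < B →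
        ∀ (T : ℕ) (f : TimedFlow n), IsIntegralRouting (uniformDemand n B) T f →
          c * worstCaseRate n (B : ℝ) ≤ (T : ℝ) ∧
          c * worstCaseRate n (B : ℝ) ≤ avgCompletionTime (uniformDemand n B) T f) ∧
      -- ALG is worst-case optimal: what it needs for any demands of row and column sums at most B
      -- is within a constant factor of what every routing needs for the uniform ones
      (∃ K : ℝ, 0 < K ∧ ∀ (n : ℕ), 2 ≤ n → ∀ (B : NNRat), 0 < B →
        ∀ (D : Matrix (Fin n) (Fin n) NNRat), SumsAtMost D (B : ℝ) →
        ∀ (T : ℕ) (f : TimedFlow n), IsIntegralRouting (uniformDemand n B) T f →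
          ((ALG n D).makespan : ℝ) ≤ K * (T : ℝ) ∧
          (ALG n D).avg D ≤ K * avgCompletionTime (uniformDemand n B) T f) := by
  refine ⟨spreadAlgorithm, isPolyTime_spreadAlgorithm, spreadAlgorithm_isIntegralRouting,
    ⟨192, by norm_num, fun n hn D B hD => ?_⟩,
    ⟨1 / 128, by norm_num, fun n hn B hB T f hf => worstCaseRate_le hn hB hf⟩,
    ⟨192 * 128, by norm_num, fun n hn B hB D hD T f hf => ?_⟩⟩
  · have havg := spreadAlgorithm_avg_le n D
    obtain ⟨h₁, h₂, h₃⟩ := spreadAlgorithm_guarantee hn hD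
    exact ⟨fun h => ⟨h₁ h, havg.trans (h₁ h)⟩, fun h h' => ⟨h₂ h h', havg.trans (h₂ h h')⟩,
      fun h => ⟨h₃ h, havg.trans (h₃ h)⟩⟩
  · have havg := spreadAlgorithm_avg_le n D
    obtain ⟨h₁, h₂, h₃⟩ := spreadAlgorithm_guarantee hn hD
    obtain ⟨l₁, l₂⟩ := worstCaseRate_le hn hB hf
    -- In each range of `B` the guarantee is one of the three terms of the maximum.
    have hup : ((spreadAlgorithm n D).makespan : ℝ) ≤ 192 * worstCaseRate n (B : ℝ) := by
      rcases le_total (B : ℝ) 2 with h | h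
      · refine (h₁ h).trans (mul_le_mul_of_nonneg_left ?_ (by norm_num))
        exact le_max_left _ _
      · rcases le_total (B : ℝ) n with h' | h'
        · refine (h₂ h h').trans (mul_le_mul_of_nonneg_left ?_ (by norm_num))
          refine le_trans ?_ (le_max_right _ _)
          rw [if_pos h]
          exact le_max_left _ _
        · refine (h₃ h').trans (mul_le_mul_of_nonneg_left ?_ (by norm_num))
          exact (le_max_right _ _).trans (le_max_right _ _)
    constructor <;> linarith
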